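/- Let $n, k \ge 1$ be integers and let $$\Omega_k^{n+1} = \{(z,w) \in \mathbb{C}^n \times \mathbb{C} : |z|^k < |w| < 1\}$$ be the generalized Hartogs triangle, where $|z|$ is the Euclidean norm. Let $A^2(\Omega_k^{n+1})$ be the space of holomorphic functions on $\Omega_k^{n+1}$ that are square integrable for Lebesgue measure $dV$. The Bergman kernel is the function $B_{k,n}$ on $\Omega_k^{n+1} \times \Omega_k^{n+1}$ such that $\overline{B_{k,n}(x,\cdot)} \in A^2(\Omega_k^{n+1})$ for every $x \in \Omega_k^{n+1}$ and such that, for every $f \in L^2(\Omega_k^{n+1})$, the function $x \mapsto \int_{\Omega_k^{n+1}} B_{k,n}(x,y) f(y)\, dV(y)$ is the orthogonal projection of $f$ to $A^2(\Omega_k^{n+1})$. Then this kernel exists, is unique, and is given as follows. For $(z,w), (s,t) \in \Omega_k^{n+1}$ put $a = w\bar t$ and $b = z \cdot \bar s = \sum_{i=1}^n z_i \bar s_i$. Then $$B_{k,n}((z,w),(s,t)) = n!\,\frac{g_{(n+1)k}(b)\,a^{n+1} + \cdots + g_{k}(b)\,a + g_{0}(b)}{\pi^{n+1}\, k\, (1-a)^2\,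 (a-b^k)^{n+1}},$$ where, for $0 \le l \le n+1$, $g_{lk}$ is the polynomial $$g_{lk}(b) = \sum_{\substack{j_1+j_2+\cdots+j_{n+3} = (n-l+2)k-(n+1),\\ 0 \le j_i \le k-1}} b^{\,j_3+j_4+\cdots+j_{n+3}},$$ and an empty sum is $0$. -/

import Mathlib

open MeasureTheory Polynomial

open scoped ComplexConjugate

/-- `f` belongs to the Bergman space `A²(Ω)`: it is holomorphic on `Ω` and square integrable
on `Ω` (only the values of `f` on `Ω` matter). -/
def IsInBergmanSpace {E : Type*} [NormedAddCommGroup E] [NormedSpace ℂ E] [MeasureSpace E]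
    (Ω : Set E) (f : E → ℂ) : Prop :=
  DifferentiableOn ℂ f Ω ∧ MemLp f 2 (volume.restrict Ω)

/-- `g` is the Bergman projection of `f ∈ L²(Ω)`: the orthogonal projection of `f` to `A²(Ω)`,
that is, `g ∈ A²(Ω)` and `f - g` is orthogonal to `A²(Ω)`. -/
def IsBergmanProjection {E : Type*} [NormedAddCommGroup E] [NormedSpace ℂ E] [MeasureSpace E]
    (Ω : Set E) (f g : E → ℂ) : Prop :=
  IsInBergmanSpace Ω g ∧
    ∀ h : E → ℂ, IsInBergmanSpace Ω h → ∫ x in Ω, (f x - g x) * conj (h x) = 0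

/-- `B` is the Bergman kernel of `Ω`: the integral operator with kernel `B` is the Bergman
projection on all of `L²(Ω)`. The first field makes the integrals converge, and pins `B` at
every point of `Ω × Ω` instead of almost everywhere. -/
structure IsBergmanKernel {E : Type*} [NormedAddCommGroup E] [NormedSpace ℂ E] [MeasureSpace E]
    (Ω : Set E) (B : E → E → ℂ) : Prop where
  conj_mem : ∀ x ∈ Ω, IsInBergmanSpace Ω (fun y => conj (B x y))
  projection : ∀ f : E → ℂ, MemLp f 2 (volume.restrict Ω) →
    IsBergmanProjection Ω f (fun x => ∫ y in Ω, B x y * f y)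

/-- The generalized Hartogs triangle `{(z, w) ∈ ℂⁿ × ℂ : |z|^k < |w| < 1}`, where `|z|` is the
Euclidean norm. The space `(Fin n → ℂ) × ℂ` carries the product Lebesgue measure. -/
def hartogsTriangle (n k : ℕ) : Set ((Fin n → ℂ) × ℂ) :=
  {p | ‖WithLp.toLp 2 p.1‖ ^ k < ‖p.2‖ ∧ ‖p.2‖ < 1}

/-- The polynomial `∑ X ^ (j₃ + ⋯ + j_{n+3})`, over all `(j₁, …, j_{n+3})` with
`0 ≤ j_i ≤ k - 1` and `j₁ + ⋯ + j_{n+3} = (n - l + 2) k - (n + 1)`. The last equation is written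
without subtraction. -/
noncomputable def kernelCoeff (n k l : ℕ) : ℂ[X] :=
  ∑ j : Fin (n + 3) → Fin k with (∑ i, (j i : ℕ)) + (n + 1) + l * k = (n + 2) * k,
    X ^ (∑ i : Fin (n + 1), (j i.succ.succ : ℕ))

/-- The closed formula for the kernel, with `a = w t̄` and `b = z · s̄ = ∑ i, z_i s̄_i`. -/
noncomputable def hartogsKernel (n k : ℕ) (p q : (Fin n → ℂ) × ℂ) : ℂ :=
  let a : ℂ := p.2 * conj q.2
  let b : ℂ := ∑ i, p.1 i * conj (q.1 i)
  (n.factorial : ℂ) * (∑ l ∈ Finset.range (n + 2), (kernelCoeff n k l).eval b * a ^ l) /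
    ((Real.pi : ℂ) ^ (n + 1) * (k : ℂ) * (1 - a) ^ 2 * (a - b ^ k) ^ (n + 1))

/-!
Write `Ω` for the Hartogs triangle, `a = w t̄` and `b = z · s̄`. The proof expands everything in the
monomials `⟨z, u⟩ ^ N * w ^ m`, with `N ∈ ℕ`, `m ∈ ℤ` and `u` a unit vector.

*The formula as a series.* Integration over balls `|z| < |w| ^ (1 / k)` gives the squared norm of
such a monomial (`lintegral_monomial`). It is finite exactly when `D = k (m + 1) + N + n` is
positive, and its inverse is then `n! * (N + n).choose n * D / (π ^ (n + 1) * k)`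
(`kernelWeight`). The closed formula is the sum of `kernelWeight * b ^ N * a ^ m`
(`hasSum_kernelWeight`): both sides are averages over the `k`-th roots `α` of `a` of
`α ^ (2 - k) / ((1 - α) ^ 2 * (α - b) ^ (n + 1))`, up to a constant factor.

*The reproducing property* (`integral_hartogsKernel_mul`). Fix `x = (σ u, w)` in `Ω` with `u`
a unit vector; then `b` only depends on `⟨s, u⟩`. A torus acts on `Ω`, by rotating `w`, `z`, and the
part of `z` orthogonal to `u`. Averaging a holomorphic `h` against characters of this torus gives
multiples `d N m` of the monomials: by the mean value property, the last rotation reduces `h` to its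
restriction to `ℂ u × ℂ`, a function of two variables with a Taylor-Laurent expansion. For
`h ∈ A²(Ω)` the coefficients of the monomials of infinite norm vanish, and the inner products
with the other ones are `d N m` times their squared norms. Integrating the series of the kernel
against `h` term by term therefore gives the expansion of `h` at `x`.

*The projection* (`isBergmanKernel_of_reproducing`). The kernel has a square integrable bound in
its second argument, locally uniform in the first (`exists_kernel_bound`), so its integral operator
maps `L²(Ω)` to holomorphic functions. Together with the reproducing property this makes `A²(Ω)`
closed in `L²(Ω)` and identifies the operator with the orthogonal projection. Uniqueness is
`IsBergmanKernel.eq_on`.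
-/

section Hartogs

variable {n k : ℕ}

/-! ### Expansion of the closed formula in monomials -/

/-- The coefficient of `b ^ N * a ^ m` in the expansion of the Bergman kernel: the inverse of the
squared `L²` norm of `⟨z, u⟩ ^ N * w ^ m` for a unit vector `u`. It is zero, through `Int.toNat`,
exactly when that monomial is not square integrable. -/
noncomputable def kernelWeight (n k N : ℕ) (m : ℤ) : ℝ :=
  n.factorial * (N + n).choose n * (k * (m + 1) + N + n : ℤ).toNat / (Real.pi ^ (n + 1) * k)

/-- Averaging `β ^ e` over the `k`-th roots `β` of `α ^ k` selects the exponents divisible by `k`. -/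
theorem sum_zpow_roots {k : ℕ} (hk : 1 ≤ k) {α ω : ℂ} (hω : IsPrimitiveRoot ω k)
    (e : ℤ) :
    ∑ i ∈ Finset.range k, (α * ω ^ i) ^ e = if (k : ℤ) ∣ e then k * (α ^ k) ^ (e / k) else 0 := by
  have hk0 : (k : ℤ) ≠ 0 := by positivity
  have h1 : ∀ i : ℕ, (α * ω ^ i) ^ e = α ^ e * (ω ^ e) ^ i := by
    intro i
    rw [mul_zpow, ← zpow_natCast ω i, ← zpow_natCast (ω ^ e) i, ← zpow_mul, ← zpow_mul, mul_comm e]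
  simp_rw [h1, ← Finset.mul_sum]
  split_ifs with h
  · obtain ⟨c, rfl⟩ := h
    have : ω ^ ((k : ℤ) * c) = 1 := by
      rw [zpow_mul, zpow_natCast, hω.pow_eq_one, one_zpow]
    rw [this, Int.mul_ediv_cancel_left _ hk0, zpow_mul, zpow_natCast]
    simp [mul_comm]
  · have h2 : ω ^ e ≠ 1 := fun h' => h ((hω.zpow_eq_one_iff_dvd e).1 h')
    rw [geom_sum_eq h2]
    have : (ω ^ e) ^ k = 1 := by
      rw [← zpow_natCast (ω ^ e), ← zpow_mul, mul_comm, zpow_mul, zpow_natCast, hω.pow_eq_one,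
        one_zpow]
    simp [this]

/-- The numerator of the kernel as an average over the `k`-th roots `α * ω ^ i` of `a`. -/
theorem sum_roots_eq_kernelCoeff {n k : ℕ} (hk : 1 ≤ k) {α ω : ℂ} (hα : α ≠ 0)
    (hω : IsPrimitiveRoot ω k) (b : ℂ) :
    ∑ i ∈ Finset.range k, (α * ω ^ i) ^ (2 - k : ℤ) *
        ((∑ j ∈ Finset.range k, (α * ω ^ i) ^ j) ^ 2 *
          (∑ j ∈ Finset.range k, b ^ j * (α * ω ^ i) ^ (k - 1 - j)) ^ (n + 1)) =
      k * ∑ l ∈ Finset.range (n + 2), (kernelCoeff n k l).eval b * (α ^ k) ^ l := by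
  have hω0 : ω ≠ 0 := hω.ne_zero (by omega)
  have key : ∀ β : ℂ, β ≠ 0 → β ^ (2 - k : ℤ) * ((∑ j ∈ Finset.range k, β ^ j) ^ 2 *
          (∑ j ∈ Finset.range k, b ^ j * β ^ (k - 1 - j)) ^ (n + 1)) =
      ∑ j : Fin (n + 3) → Fin k, b ^ (∑ i : Fin (n + 1), (j i.succ.succ : ℕ)) *
        β ^ ((n + 2) * k - (n + 1) - ∑ i, (j i : ℕ) : ℤ) := by
    intro β hβ
    have e1 : ∑ j ∈ Finset.range k, β ^ j = ∑ j : Fin k, (1 : ℂ) ^ (j : ℕ) * β ^ (k - 1 - j) := by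
      rw [← Finset.sum_range_reflect, Finset.sum_range]
      simp
    have e2 : (∑ j ∈ Finset.range k, β ^ j) ^ 2 *
          (∑ j ∈ Finset.range k, b ^ j * β ^ (k - 1 - j)) ^ (n + 1) =
        ∏ i : Fin (n + 3), ∑ j : Fin k,
          ((Fin.cons 1 (Fin.cons 1 fun _ => b) : Fin (n + 3) → ℂ) i) ^ (j : ℕ) *
            β ^ (k - 1 - j) := by
      rw [Fin.prod_univ_succ, Fin.prod_univ_succ]
      simp only [Fin.cons_zero, Fin.cons_succ, Finset.prod_const, Finset.card_univ,
        Fintype.card_fin, ← e1]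
      rw [Finset.sum_range (fun j => b ^ j * β ^ (k - 1 - j))]
      ring
    rw [e2, Finset.prod_univ_sum, Fintype.piFinset_univ, Finset.mul_sum]
    refine Finset.sum_congr rfl fun j _ => ?_
    rw [Finset.prod_mul_distrib, Finset.prod_pow_eq_pow_sum]
    have e3 : ∏ i, ((Fin.cons 1 (Fin.cons 1 fun _ => b) : Fin (n + 3) → ℂ) i) ^ (j i : ℕ) =
        b ^ (∑ i : Fin (n + 1), (j i.succ.succ : ℕ)) := by
      rw [Fin.prod_univ_succ, Fin.prod_univ_succ]
      simp [Finset.prod_pow_eq_pow_sum]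
    rw [e3, mul_left_comm, ← zpow_natCast β, ← zpow_add₀ hβ]
    congr 2
    have : ∀ i, ((k - 1 - (j i : ℕ) : ℕ) : ℤ) = k - 1 - (j i : ℕ) := by
      intro i
      have := (j i).2
      omega
    push_cast
    simp_rw [this]
    simp only [Finset.sum_sub_distrib, Finset.sum_const, Finset.card_univ, Fintype.card_fin]
    simp
    ring
  have hne : ∀ i : ℕ, α * ω ^ i ≠ 0 := fun i => mul_ne_zero hα (pow_ne_zero _ hω0)
  rw [Finset.sum_congr rfl fun i _ => key _ (hne i), Finset.sum_comm]
  simp_rw [← Finset.mul_sum, sum_zpow_roots hk hω, kernelCoeff, eval_finsetSum, eval_pow,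
    eval_X, Finset.sum_filter, Finset.sum_mul]
  rw [Finset.sum_comm, Finset.mul_sum]
  refine Finset.sum_congr rfl fun j _ => ?_
  have hk0 : (0 : ℤ) < k := by positivity
  have hs : ∑ i, (j i : ℕ) ≤ (n + 3) * (k - 1) := by
    refine (Finset.sum_le_card_nsmul _ _ (k - 1) fun i _ => by have := (j i).2; omega).trans ?_
    simp
  have hs' : ∑ i, ((j i : ℕ) : ℤ) ≤ (n + 3) * (k - 1) := by
    have : ((k - 1 : ℕ) : ℤ) = k - 1 := by omega
    calc ∑ i, ((j i : ℕ) : ℤ) = ((∑ i, (j i : ℕ) : ℕ) : ℤ) := by push_cast; rfl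
      _ ≤ (((n + 3) * (k - 1) : ℕ) : ℤ) := by exact_mod_cast hs
      _ = _ := by push_cast [this]; ring
  have hs0 : 0 ≤ ∑ i, ((j i : ℕ) : ℤ) := Finset.sum_nonneg fun i _ => by positivity
  push_cast
  split_ifs with h
  · obtain ⟨c, hc⟩ := h
    have hc0 : 0 ≤ c := by
      by_contra hneg
      nlinarith
    have hcn : c < n + 2 := by
      by_contra hneg
      nlinarith
    lift c to ℕ using hc0
    rw [hc, Int.mul_ediv_cancel_left _ hk0.ne', zpow_natCast]
    rw [Finset.sum_eq_single c]
    · rw [if_pos]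
      · ring
      · zify
        linarith
    · intro l _ hl
      rw [if_neg, zero_mul]
      intro h
      zify at h
      apply hl
      have : (k : ℤ) * l = k * c := by linarith
      exact_mod_cast mul_left_cancel₀ hk0.ne' this
    · intro h
      exact absurd (Finset.mem_range.2 (by omega)) h
  · rw [mul_zero, Finset.sum_eq_zero, mul_zero]
    intro l _
    rw [if_neg, zero_mul]
    intro h'
    apply h
    zify at h'
    exact ⟨l, by linarith⟩

/-- Sum of a binomial series times a differentiated geometric series. -/
theorem hasSum_choose_mul_geometric_mul {n : ℕ} {x y : ℂ} (hx : ‖x‖ < 1) (hy : ‖y‖ < 1) :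
    HasSum (fun p : ℕ × ℕ => ((p.1 + n).choose n * y ^ p.1) * (p.2 * x ^ p.2))
      (1 / (1 - y) ^ (n + 1) * (x / (1 - x) ^ 2)) := by
  have h1 := hasSum_choose_mul_geometric_of_norm_lt_one n hy
  have h2 := hasSum_coe_mul_geometric_of_norm_lt_one hx
  have h3 := summable_mul_of_summable_norm h1.summable.norm h2.summable.norm
  have h4 := h1.mul h2 h3
  exact h4

set_option maxHeartbeats 800000 in
/-- The closed formula of the kernel as a sum of monomials. Both sides are averaged over the
`k`-th roots `α` of `a`, where the sum becomes that of a product of two one-variable series in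
`α` and `b / α`. -/
theorem hasSum_kernelWeight {n k : ℕ} (hk : 1 ≤ k) {a b : ℂ} (hab : ‖b‖ ^ k < ‖a‖)
    (ha : ‖a‖ < 1) :
    HasSum (fun p : ℕ × ℤ => (kernelWeight n k p.1 p.2 : ℂ) * (b ^ p.1 * a ^ p.2))
      ((n.factorial : ℂ) * (∑ l ∈ Finset.range (n + 2), (kernelCoeff n k l).eval b * a ^ l) /
        ((Real.pi : ℂ) ^ (n + 1) * (k : ℂ) * (1 - a) ^ 2 * (a - b ^ k) ^ (n + 1))) := by
  have hk0 : k ≠ 0 := by omega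
  have hkC : (k : ℂ) ≠ 0 := by exact_mod_cast hk0
  have ha0 : a ≠ 0 := norm_pos_iff.1 (lt_of_le_of_lt (by positivity) hab)
  obtain ⟨α, hα⟩ := IsAlgClosed.exists_pow_nat_eq a (Nat.pos_of_ne_zero hk0)
  have hα0 : α ≠ 0 := by
    rintro rfl
    rw [zero_pow hk0] at hα
    exact ha0 hα.symm
  obtain ⟨ω, hω⟩ : ∃ ω : ℂ, IsPrimitiveRoot ω k := ⟨_, Complex.isPrimitiveRoot_exp k hk0⟩
  have hω0 : ω ≠ 0 := hω.ne_zero hk0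
  have hne : ∀ i : ℕ, α * ω ^ i ≠ 0 := fun i => mul_ne_zero hα0 (pow_ne_zero _ hω0)
  have hroot : ∀ i : ℕ, (α * ω ^ i) ^ k = a := by
    intro i
    rw [mul_pow, ← pow_mul, mul_comm i, pow_mul, hω.pow_eq_one, one_pow, mul_one, hα]
  have hlt : ∀ i : ℕ, ‖α * ω ^ i‖ < 1 := by
    intro i
    refine lt_of_pow_lt_pow_left₀ k zero_le_one ?_
    rw [← norm_pow, hroot, one_pow]
    exact ha
  have hlt' : ∀ i : ℕ, ‖b / (α * ω ^ i)‖ < 1 := by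
    intro i
    rw [norm_div, div_lt_one (norm_pos_iff.2 (hne i))]
    refine lt_of_pow_lt_pow_left₀ k (norm_nonneg _) ?_
    rw [← norm_pow (α * ω ^ i), hroot]
    exact hab
  have hsum := hasSum_sum (s := Finset.range k) fun i _ =>
    (hasSum_choose_mul_geometric_mul (n := n) (hlt i) (hlt' i)).mul_left
      ((α * ω ^ i) ^ (-(n : ℤ) - k))
  have hterm : ∀ p : ℕ × ℕ, (∑ i ∈ Finset.range k, (α * ω ^ i) ^ (-(n : ℤ) - k) *
      (((p.1 + n).choose n * (b / (α * ω ^ i)) ^ p.1) * (p.2 * (α * ω ^ i) ^ p.2))) =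
      (p.1 + n).choose n * b ^ p.1 * p.2 *
        if (k : ℤ) ∣ p.2 - p.1 - n - k then k * a ^ (((p.2 : ℤ) - p.1 - n - k) / k) else 0 := by
    intro p
    rw [← hα, ← sum_zpow_roots hk hω, Finset.mul_sum]
    refine Finset.sum_congr rfl fun i _ => ?_
    have : (α * ω ^ i) ^ ((p.2 : ℤ) - p.1 - n - k) =
        (α * ω ^ i) ^ (-(n : ℤ) - k) * (α * ω ^ i) ^ p.2 / (α * ω ^ i) ^ p.1 := by
      rw [← zpow_natCast (α * ω ^ i) p.2, ← zpow_natCast (α * ω ^ i) p.1, ← zpow_add₀ (hne i),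
        ← zpow_sub₀ (hne i)]
      congr 1
      ring
    rw [this, div_pow]
    ring
  have hval : ∀ i : ℕ, (α * ω ^ i) ^ (-(n : ℤ) - k) * (1 / (1 - b / (α * ω ^ i)) ^ (n + 1) *
      (α * ω ^ i / (1 - α * ω ^ i) ^ 2)) =
      (α * ω ^ i) ^ (2 - k : ℤ) *
        ((∑ j ∈ Finset.range k, (α * ω ^ i) ^ j) ^ 2 *
          (∑ j ∈ Finset.range k, b ^ j * (α * ω ^ i) ^ (k - 1 - j)) ^ (n + 1)) /
        ((1 - a) ^ 2 * (a - b ^ k) ^ (n + 1)) := by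
    intro i
    have hr := hroot i
    have hβ := hne i
    have hl := hlt i
    have hl' := hlt' i
    generalize α * ω ^ i = β at hr hβ hl hl' ⊢
    have g1 : (∑ j ∈ Finset.range k, β ^ j) * (1 - β) = 1 - a := by
      rw [geom_sum_mul_neg, hr]
    have g2 : (∑ j ∈ Finset.range k, b ^ j * β ^ (k - 1 - j)) * (β - b) = a - b ^ k := by
      have := geom_sum₂_mul b β k
      rw [hr] at this
      linear_combination -this
    have n1 : 1 - β ≠ 0 := by
      intro h
      rw [← sub_eq_zero.1 h, norm_one] at hl
      exact lt_irrefl _ hl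
    have n2 : β - b ≠ 0 := by
      intro h
      rw [← sub_eq_zero.1 h, div_self hβ, norm_one] at hl'
      exact lt_irrefl _ hl'
    have n3 : 1 - a ≠ 0 := by
      intro h
      rw [← sub_eq_zero.1 h, norm_one] at ha
      exact lt_irrefl _ ha
    have n4 : a - b ^ k ≠ 0 := by
      intro h
      rw [sub_eq_zero.1 h, norm_pow] at hab
      exact lt_irrefl _ hab
    have e1 : 1 - b / β = (β - b) / β := by field_simp
    have e2 : β ^ (2 - k : ℤ) = β ^ (-(n : ℤ) - k) * β ^ (n + 1) * β := by
      rw [← zpow_natCast β (n + 1), ← zpow_add₀ hβ, ← zpow_add_one₀ hβ]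
      congr 1
      push_cast
      ring
    rw [e1, e2, ← g1, ← g2]
    have s1 : (∑ j ∈ Finset.range k, β ^ j) ≠ 0 := fun h => by
      rw [h, zero_mul] at g1; exact n3 g1.symm
    have s2 : (∑ j ∈ Finset.range k, b ^ j * β ^ (k - 1 - j)) ≠ 0 := fun h => by
      rw [h, zero_mul] at g2; exact n4 g2.symm
    rw [div_pow, mul_pow, mul_pow]
    field_simp
  simp_rw [hterm, hval] at hsum
  rw [← Finset.sum_div, sum_roots_eq_kernelCoeff hk hα0 hω, hα] at hsum
  have h2 := hsum.mul_left ((n.factorial : ℂ) / ((Real.pi : ℂ) ^ (n + 1) * k * k))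
  have hpi : (Real.pi : ℂ) ≠ 0 := by exact_mod_cast Real.pi_ne_zero
  have hfin : ((n.factorial : ℂ) *
        (∑ l ∈ Finset.range (n + 2), (kernelCoeff n k l).eval b * a ^ l) /
        ((Real.pi : ℂ) ^ (n + 1) * (k : ℂ) * (1 - a) ^ 2 * (a - b ^ k) ^ (n + 1))) =
      (n.factorial : ℂ) / ((Real.pi : ℂ) ^ (n + 1) * k * k) *
      (k * (∑ l ∈ Finset.range (n + 2), (kernelCoeff n k l).eval b * a ^ l) /
        ((1 - a) ^ 2 * (a - b ^ k) ^ (n + 1))) := by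
    generalize (∑ l ∈ Finset.range (n + 2), (kernelCoeff n k l).eval b * a ^ l) = S
    simp only [div_eq_mul_inv, mul_inv]
    field_simp
  rw [hfin]
  have hz : (0 : ℤ) < k := by positivity
  -- The power `d` of `α` in the geometric series corresponds to `d = k * (m + 1) + N + n`;
  -- terms with `d = 0` or with `d - N - n` not divisible by `k` vanish.
  refine (hasSum_iff_hasSum_of_ne_zero_bij
    (fun p => (p.1.1, ((k : ℤ) * (p.1.2 + 1) + p.1.1 + n).toNat)) ?_ ?_ ?_).1 h2
  · rintro ⟨⟨N, m⟩, h⟩ ⟨⟨N', m'⟩, h'⟩ heq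
    rw [Prod.mk.injEq] at heq
    obtain ⟨h0, h3⟩ := heq
    dsimp only at h0 h3
    subst h0
    have d1 : ((k : ℤ) * (m + 1) + N + n).toNat ≠ 0 := by
      intro h0
      apply h
      simp [kernelWeight, h0]
    have h4 : (k : ℤ) * (m + 1) = k * (m' + 1) := by omega
    have := mul_left_cancel₀ hz.ne' h4
    rw [Subtype.mk.injEq, Prod.mk.injEq]
    exact ⟨rfl, by omega⟩
  · rintro ⟨N, d⟩ hd
    have hd' : (k : ℤ) ∣ d - N - n - k := by
      by_contra hcon
      rw [Function.mem_support] at hd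
      rw [if_neg hcon, mul_zero, mul_zero] at hd
      exact hd rfl
    obtain ⟨m, hm⟩ := hd'
    have e : (k : ℤ) * (m + 1) + N + n = d := by linarith
    have e' : (((k : ℤ) * (m + 1) + N + n).toNat) = d := by omega
    refine ⟨⟨(N, m), ?_⟩, ?_⟩
    · rw [Function.mem_support] at hd ⊢
      intro h0
      apply hd
      simp only [kernelWeight, e', hm, dvd_mul_right, if_true,
        Int.mul_ediv_cancel_left _ hz.ne'] at h0 ⊢
      push_cast at h0
      have h1 : ∀ x y c d F P K : ℂ, F / (P * K * K) * (c * x * d * (K * y)) =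
          (F * c * d / (P * K) * (x * y)) * (K / K) := by intros; ring
      rw [h1, h0, zero_mul]
    · simp only [e']
  · rintro ⟨⟨N, m⟩, h⟩
    have d1 : ((k : ℤ) * (m + 1) + N + n).toNat ≠ 0 := by
      intro h0
      apply h
      simp [kernelWeight, h0]
    have hm : ((((k : ℤ) * (m + 1) + N + n).toNat : ℕ) : ℤ) - N - n - k = k * m := by
      have : ((((k : ℤ) * (m + 1) + N + n).toNat : ℕ) : ℤ) = (k : ℤ) * (m + 1) + N + n := by
        omega
      rw [this]; ring
    simp only [hm, dvd_mul_right, if_true, Int.mul_ediv_cancel_left _ hz.ne', kernelWeight]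
    push_cast
    field_simp

/-! ### Hermitian product, geometry and symmetries of the Hartogs triangle -/

/-- The Hermitian product `z · s̄ = ∑ i, z_i s̄_i` on `ℂⁿ`, linear in the first argument. -/
noncomputable def herm {n : ℕ} (z s : Fin n → ℂ) : ℂ := ∑ i, z i * conj (s i)

theorem herm_eq_inner (z s : Fin n → ℂ) :
    herm z s = inner ℂ (WithLp.toLp 2 s) (WithLp.toLp 2 z) := by
  simp [herm, PiLp.inner_apply]

theorem norm_herm_le (z s : Fin n → ℂ) :
    ‖herm z s‖ ≤ ‖WithLp.toLp 2 z‖ * ‖WithLp.toLp 2 s‖ := by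
  rw [herm_eq_inner, mul_comm]
  exact norm_inner_le_norm _ _

theorem herm_add (x y s : Fin n → ℂ) : herm (x + y) s = herm x s + herm y s := by
  simp [herm, add_mul, Finset.sum_add_distrib]

theorem herm_sub (x y s : Fin n → ℂ) : herm (x - y) s = herm x s - herm y s := by
  simp [herm, sub_mul, Finset.sum_sub_distrib]

theorem herm_smul (c : ℂ) (x s : Fin n → ℂ) : herm (c • x) s = c * herm x s := by
  simp [herm, Finset.mul_sum, mul_assoc]

theorem conj_herm (x y : Fin n → ℂ) : conj (herm x y) = herm y x := by
  simp [herm, mul_comm]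

theorem herm_smul_right (c : ℂ) (x s : Fin n → ℂ) : herm x (c • s) = conj c * herm x s := by
  rw [← conj_herm, herm_smul, map_mul, conj_herm]

theorem herm_self (x : Fin n → ℂ) : herm x x = (‖WithLp.toLp 2 x‖ : ℂ) ^ 2 := by
  rw [herm_eq_inner, inner_self_eq_norm_sq_to_K]
  rfl

theorem continuous_toLp_norm : Continuous fun s : Fin n → ℂ => ‖WithLp.toLp 2 s‖ :=
  (PiLp.continuous_toLp 2 _).norm

theorem continuous_herm_left (u : Fin n → ℂ) : Continuous fun s : Fin n → ℂ => herm s u := by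
  unfold herm
  fun_prop

theorem isOpen_hartogsTriangle : IsOpen (hartogsTriangle n k) := by
  have h1 : Continuous fun p : (Fin n → ℂ) × ℂ => ‖WithLp.toLp 2 p.1‖ :=
    continuous_toLp_norm.comp continuous_fst
  exact (isOpen_lt (h1.pow k) continuous_snd.norm).inter
    (isOpen_lt continuous_snd.norm continuous_const)

theorem measurableSet_hartogsTriangle : MeasurableSet (hartogsTriangle n k) :=
  isOpen_hartogsTriangle.measurableSet

theorem snd_ne_zero_of_mem {p : (Fin n → ℂ) × ℂ} (hp : p ∈ hartogsTriangle n k) : p.2 ≠ 0 :=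
  norm_pos_iff.1 (lt_of_le_of_lt (by positivity) hp.1)

theorem norm_fst_lt_one_of_mem {p : (Fin n → ℂ) × ℂ} (hp : p ∈ hartogsTriangle n k) :
    ‖WithLp.toLp 2 p.1‖ < 1 := by
  by_contra h
  exact absurd (hp.1.trans hp.2) (not_lt.2 (one_le_pow₀ (not_lt.1 h)))

/-- A linear map of `ℂⁿ` preserving a norm preserves Lebesgue measure: it multiplies the measure by
a constant, and the unit ball, of finite positive measure, is its own preimage. The norm is given as
that of the image under an injective linear map `e`, since the norm of `Fin n → ℂ` is not the
Euclidean one. -/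
theorem measurePreserving_of_norm_map {V : Type*} [NormedAddCommGroup V] [NormedSpace ℝ V]
    [FiniteDimensional ℝ V] (e : (Fin n → ℂ) →ₗ[ℝ] V) (he : Function.Injective e)
    (T : (Fin n → ℂ) →ₗ[ℝ] (Fin n → ℂ)) (hT : ∀ s, ‖e (T s)‖ = ‖e s‖) :
    MeasurePreserving T volume volume := by
  have hinj : Function.Injective T := by
    rw [injective_iff_map_eq_zero]
    intro s hs
    have h := hT s
    rw [hs, map_zero, norm_zero, eq_comm, norm_eq_zero] at h
    exact (injective_iff_map_eq_zero e).1 he s h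
  have hdet : LinearMap.det T ≠ 0 := by
    have := (LinearEquiv.ofInjectiveEndo T hinj).isUnit_det'
    exact this.ne_zero
  have hmap := Measure.map_linearMap_addHaar_eq_smul_addHaar (volume : Measure (Fin n → ℂ)) hdet
  have hTc : Continuous T := T.continuous_of_finiteDimensional
  have hec : Continuous e := e.continuous_of_finiteDimensional
  refine ⟨hTc.measurable, ?_⟩
  set B : Set (Fin n → ℂ) := {s | ‖e s‖ < 1} with hB
  have hBo : IsOpen B := isOpen_lt hec.norm continuous_const
  have h1 : Measure.map T volume B = volume B := by
    rw [Measure.map_apply hTc.measurable hBo.measurableSet]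
    congr 1
    ext s
    simp [hB, hT]
  have hpos : volume B ≠ 0 := (hBo.measure_pos volume ⟨0, by simp [hB]⟩).ne'
  have hfin : volume B ≠ ⊤ := by
    have hbd : Bornology.IsBounded B := by
      obtain ⟨K, -, hK⟩ := e.exists_antilipschitzWith (LinearMap.ker_eq_bot.2 he)
      have := hK.isBounded_preimage (Metric.isBounded_ball (x := (0 : V)) (r := 1))
      refine this.subset fun s hs => ?_
      simpa [hB] using hs
    exact hbd.measure_lt_top.ne
  rw [hmap] at h1 ⊢
  rw [Measure.smul_apply, smul_eq_mul] at h1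
  have : ENNReal.ofReal |(LinearMap.det T)⁻¹| = 1 := by
    have h2 : ENNReal.ofReal |(LinearMap.det T)⁻¹| * volume B = 1 * volume B := by rw [h1, one_mul]
    exact (ENNReal.mul_left_inj hpos hfin).1 h2
  rw [this, one_smul]

/-- The linear map `x + y ↦ c x + c d y` of `ℂⁿ`, for `x ∈ ℂ u` and `y` orthogonal to `u`,
together with multiplication by `e` on the last coordinate. For a unit vector `u` and `c, d, e` on
the unit circle, this is an action of a three-dimensional torus on the Hartogs triangle. -/
noncomputable def torusAct (u : Fin n → ℂ) (c d e : ℂ) (p : (Fin n → ℂ) × ℂ) : (Fin n → ℂ) × ℂ :=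
  (c • (herm p.1 u • u + d • (p.1 - herm p.1 u • u)), e * p.2)

theorem norm_torusAct_fst {u : Fin n → ℂ} (hu : ‖WithLp.toLp 2 u‖ = 1) {d : ℂ} (s : Fin n → ℂ) :
    ‖WithLp.toLp 2 (herm s u • u + d • (s - herm s u • u))‖ ^ 2 =
      ‖WithLp.toLp 2 s‖ ^ 2 + (‖d‖ ^ 2 - 1) * ‖WithLp.toLp 2 (s - herm s u • u)‖ ^ 2 := by
  have hor : ∀ d : ℂ, inner ℂ (WithLp.toLp 2 (herm s u • u))
      (WithLp.toLp 2 (d • (s - herm s u • u))) = 0 := by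
    intro d
    rw [← herm_eq_inner, herm_smul, herm_smul_right, herm_sub, herm_smul, herm_self, hu]
    simp
  have hpy : ∀ d : ℂ, ‖WithLp.toLp 2 (herm s u • u + d • (s - herm s u • u))‖ ^ 2 =
      ‖WithLp.toLp 2 (herm s u • u)‖ ^ 2 + ‖d‖ ^ 2 * ‖WithLp.toLp 2 (s - herm s u • u)‖ ^ 2 := by
    intro d
    have := norm_add_sq_eq_norm_sq_add_norm_sq_of_inner_eq_zero _ _ (hor d)
    rw [WithLp.toLp_add, sq, this, WithLp.toLp_smul 2 d, norm_smul]
    ring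
  have h1 := hpy 1
  rw [one_smul, add_sub_cancel, norm_one] at h1
  rw [hpy, h1]
  ring

theorem norm_torusAct_le {u : Fin n → ℂ} (hu : ‖WithLp.toLp 2 u‖ = 1) {d : ℂ} (hd : ‖d‖ ≤ 1)
    (s : Fin n → ℂ) :
    ‖WithLp.toLp 2 (herm s u • u + d • (s - herm s u • u))‖ ≤ ‖WithLp.toLp 2 s‖ := by
  refine (pow_le_pow_iff_left₀ (norm_nonneg _) (norm_nonneg _) two_ne_zero).1 ?_
  rw [norm_torusAct_fst hu]
  have : ‖d‖ ^ 2 ≤ 1 := pow_le_one₀ (norm_nonneg _) hd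
  nlinarith [sq_nonneg ‖WithLp.toLp 2 (s - herm s u • u)‖]

theorem norm_torusAct_eq {u : Fin n → ℂ} (hu : ‖WithLp.toLp 2 u‖ = 1) {c d : ℂ} (hc : ‖c‖ = 1)
    (hd : ‖d‖ = 1) (s : Fin n → ℂ) :
    ‖WithLp.toLp 2 (c • (herm s u • u + d • (s - herm s u • u)))‖ = ‖WithLp.toLp 2 s‖ := by
  rw [WithLp.toLp_smul, norm_smul, hc, one_mul]
  refine (pow_left_inj₀ (norm_nonneg _) (norm_nonneg _) two_ne_zero).1 ?_
  rw [norm_torusAct_fst hu, hd]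
  ring

theorem herm_torusAct {u : Fin n → ℂ} (hu : ‖WithLp.toLp 2 u‖ = 1) (c d e : ℂ)
    (p : (Fin n → ℂ) × ℂ) : herm (torusAct u c d e p).1 u = c * herm p.1 u := by
  simp [torusAct, herm_smul, herm_add, herm_sub, herm_self, hu]

theorem torusAct_mem_iff {u : Fin n → ℂ} (hu : ‖WithLp.toLp 2 u‖ = 1) {c d e : ℂ} (hc : ‖c‖ = 1)
    (hd : ‖d‖ = 1) (he : ‖e‖ = 1) (p : (Fin n → ℂ) × ℂ) :
    torusAct u c d e p ∈ hartogsTriangle n k ↔ p ∈ hartogsTriangle n k := by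
  simp only [hartogsTriangle, torusAct, Set.mem_ofPred_eq, norm_torusAct_eq hu hc hd, norm_mul, he,
    one_mul]

theorem measurePreserving_torusAct {u : Fin n → ℂ} (hu : ‖WithLp.toLp 2 u‖ = 1) {c d e : ℂ}
    (hc : ‖c‖ = 1) (hd : ‖d‖ = 1) (he : ‖e‖ = 1) :
    MeasurePreserving (torusAct u c d e) (volume.restrict (hartogsTriangle n k))
      (volume.restrict (hartogsTriangle n k)) := by
  have h1 : MeasurePreserving
      (fun s : Fin n → ℂ => c • (herm s u • u + d • (s - herm s u • u))) volume volume := by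
    let T : (Fin n → ℂ) →ₗ[ℝ] (Fin n → ℂ) :=
      { toFun := fun s => c • (herm s u • u + d • (s - herm s u • u))
        map_add' := fun x y => by
          rw [herm_add]
          module
        map_smul' := fun r x => by
          have h : r • x = (r : ℂ) • x := by ext i; simp
          rw [h, herm_smul, RingHom.id_apply, ← Complex.coe_smul]
          module }
    let e : (Fin n → ℂ) →ₗ[ℝ] EuclideanSpace ℂ (Fin n) :=
      (WithLp.linearEquiv 2 ℝ (Fin n → ℂ)).symm.toLinearMap
    exact measurePreserving_of_norm_map e (WithLp.linearEquiv 2 ℝ (Fin n → ℂ)).symm.injective T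
      fun s => norm_torusAct_eq hu hc hd s
  have h2 : MeasurePreserving (fun t : ℂ => e * t) volume volume := by
    have := (rotation ⟨e, by simpa [Submonoid.unitSphere] using he⟩).measurePreserving
    exact this
  have h3 := (h1.prod h2).restrict_preimage (measurableSet_hartogsTriangle (n := n) (k := k))
  have h4 : Prod.map (fun s : Fin n → ℂ => c • (herm s u • u + d • (s - herm s u • u)))
      (fun t : ℂ => e * t) ⁻¹' hartogsTriangle n k = hartogsTriangle n k := by
    ext p
    exact torusAct_mem_iff hu hc hd he p
  rw [h4] at h3
  exact h3

section Average

variable {G E : Type*} [MeasurableSpace G] [MeasurableSpace E] {ν : Measure G}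
  [IsProbabilityMeasure ν] {μ : Measure E} [SFinite μ] {ρ : G → E → E}

theorem measurePreserving_action (hρ : Measurable (Function.uncurry ρ))
    (hp : ∀ g, MeasurePreserving (ρ g) μ μ) :
    MeasurePreserving (fun q : E × G => ρ q.2 q.1) (μ.prod ν) μ := by
  have h1 : MeasurePreserving (fun p : G × E => (p.1, ρ p.1 p.2)) (ν.prod μ) (ν.prod μ) :=
    (MeasurePreserving.id ν).skew_product hρ (Filter.Eventually.of_forall fun g => (hp g).map_eq)
  exact (measurePreserving_snd.comp h1).comp Measure.measurePreserving_swap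

/-- An integral equals the integral of the average over a group of symmetries. -/
theorem integral_eq_integral_average {F : E → ℂ} (hρ : Measurable (Function.uncurry ρ))
    (hp : ∀ g, MeasurePreserving (ρ g) μ μ) (hF : Integrable F μ) :
    ∫ y, F y ∂μ = ∫ y, ∫ g, F (ρ g y) ∂ν ∂μ := by
  have h := measurePreserving_action (ν := ν) hρ hp
  have h1 : Integrable (fun q : E × G => F (ρ q.2 q.1)) (μ.prod ν) :=
    h.integrable_comp_of_integrable hF
  rw [← integral_prod _ h1]
  have h2 := integral_map (μ := μ.prod ν) h.measurable.aemeasurable (f := F) (by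
    rw [h.map_eq]; exact hF.1)
  rw [h.map_eq] at h2
  exact h2

theorem lintegral_eq_lintegral_average {F : E → ENNReal} (hρ : Measurable (Function.uncurry ρ))
    (hp : ∀ g, MeasurePreserving (ρ g) μ μ) (hF : AEMeasurable F μ) :
    ∫⁻ y, F y ∂μ = ∫⁻ y, ∫⁻ g, F (ρ g y) ∂ν ∂μ := by
  have h := measurePreserving_action (ν := ν) hρ hp
  have h1 : AEMeasurable (fun q : E × G => F (ρ q.2 q.1)) (μ.prod ν) :=
    hF.comp_quasiMeasurePreserving h.quasiMeasurePreserving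
  rw [← lintegral_prod _ h1]
  have h2 := lintegral_map' (μ := μ.prod ν) (f := F) (by rw [h.map_eq]; exact hF)
    h.measurable.aemeasurable
  rw [h.map_eq] at h2
  exact h2

end Average

/-! ### Norms of monomials -/

theorem gaussian_complex (N : ℕ) :
    Integrable (fun z : ℂ => ‖z‖ ^ (2 * N) * Real.exp (-‖z‖ ^ 2)) ∧
      ∫ z : ℂ, ‖z‖ ^ (2 * N) * Real.exp (-‖z‖ ^ 2) = Real.pi * N.factorial := by
  have h := Complex.integral_rpow_mul_exp_neg_rpow (p := 2) (q := 2 * N) (by norm_num)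
    (by have : (0 : ℝ) ≤ 2 * N := by positivity
        linarith)
  have h1 : ∫ z : ℂ, ‖z‖ ^ (2 * N) * Real.exp (-‖z‖ ^ 2) = Real.pi * N.factorial := by
    have e : ((2 * N + 2) / 2 : ℝ) = N + 1 := by ring
    rw [e, Real.Gamma_nat_eq_factorial] at h
    rw [show (2 * Real.pi / 2 * (N.factorial : ℝ)) = Real.pi * N.factorial by ring] at h
    rw [← h]
    congr 1
    ext z
    rw [← Real.rpow_natCast, ← Real.rpow_natCast]
    push_cast
    rfl
  refine ⟨?_, h1⟩
  by_contra hcon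
  rw [integral_undef hcon] at h1
  have : (0 : ℝ) < Real.pi * N.factorial := by positivity
  linarith

theorem lintegral_gaussian_coord (N : ℕ) (i₀ : Fin n) :
    ∫⁻ s : Fin n → ℂ, ENNReal.ofReal (‖s i₀‖ ^ (2 * N) * Real.exp (-‖WithLp.toLp 2 s‖ ^ 2)) =
      ENNReal.ofReal (Real.pi ^ n * N.factorial) := by
  set f : Fin n → ℂ → ℝ := fun i z =>
    ‖z‖ ^ (2 * (if i = i₀ then N else 0)) * Real.exp (-‖z‖ ^ 2) with hf
  have hprod : ∀ s : Fin n → ℂ, ‖s i₀‖ ^ (2 * N) * Real.exp (-‖WithLp.toLp 2 s‖ ^ 2) =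
      ∏ i, f i (s i) := by
    intro s
    rw [EuclideanSpace.norm_sq_eq, ← Finset.sum_neg_distrib, Real.exp_sum]
    simp only [hf]
    rw [Finset.prod_mul_distrib]
    congr 1
    rw [Finset.prod_eq_single i₀]
    · simp
    · intro i _ hi
      simp [hi]
    · simp
  have hint : Integrable (fun s : Fin n → ℂ => ∏ i, f i (s i)) :=
    Integrable.fintype_prod fun i => (gaussian_complex _).1
  simp_rw [hprod]
  rw [← ofReal_integral_eq_lintegral_ofReal hint
    (Filter.Eventually.of_forall fun s => Finset.prod_nonneg fun i _ => by positivity),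
    integral_fintype_prod_volume_eq_prod]
  congr 1
  simp only [hf, (gaussian_complex _).2, Finset.prod_mul_distrib]
  simp only [Finset.prod_const, Finset.card_univ, Fintype.card_fin]
  congr 1
  rw [Finset.prod_eq_single i₀]
  · simp
  · intro i _ hi
    simp [hi]
  · simp

theorem lintegral_gaussian_herm (hn : 1 ≤ n) {u : Fin n → ℂ} (hu : ‖WithLp.toLp 2 u‖ = 1) (N : ℕ) :
    ∫⁻ s : Fin n → ℂ, ENNReal.ofReal (‖herm s u‖ ^ (2 * N)) *
        ENNReal.ofReal (Real.exp (-‖WithLp.toLp 2 s‖ ^ 2)) =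
      ENNReal.ofReal (Real.pi ^ n * N.factorial) := by
  let i₀ : Fin n := ⟨0, hn⟩
  obtain ⟨b, hb⟩ := Orthonormal.exists_orthonormalBasis_extension_of_card_eq (𝕜 := ℂ)
    (E := EuclideanSpace ℂ (Fin n)) (ι := Fin n) (by simp)
    (v := fun _ => WithLp.toLp 2 u) (s := {i₀}) (by
      rw [orthonormal_subsingleton_iff]
      intro i
      simpa using hu)
  have hb0 : b i₀ = WithLp.toLp 2 u := hb i₀ rfl
  let e := (WithLp.linearEquiv 2 ℂ (Fin n → ℂ))
  let T : (Fin n → ℂ) →ₗ[ℝ] (Fin n → ℂ) :=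
    ((e.symm.trans b.repr.toLinearEquiv).trans e).toLinearMap.restrictScalars ℝ
  have hT : ∀ s, T s = (b.repr (WithLp.toLp 2 s)).ofLp := fun s => rfl
  have hT0 : ∀ s, T s i₀ = herm s u := by
    intro s
    rw [hT, OrthonormalBasis.repr_apply_apply, hb0, herm_eq_inner]
  have hTn : ∀ s, ‖WithLp.toLp 2 (T s)‖ = ‖WithLp.toLp 2 s‖ := by
    intro s
    rw [hT, WithLp.toLp_ofLp, LinearIsometryEquiv.norm_map]
  have hp := measurePreserving_of_norm_map
    (WithLp.linearEquiv 2 ℝ (Fin n → ℂ)).symm.toLinearMap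
    (WithLp.linearEquiv 2 ℝ (Fin n → ℂ)).symm.injective T hTn
  rw [← lintegral_gaussian_coord N i₀, ← hp.lintegral_comp (f := fun s => ENNReal.ofReal
    (‖s i₀‖ ^ (2 * N) * Real.exp (-‖WithLp.toLp 2 s‖ ^ 2)))]
  · congr 1
    ext s
    rw [← ENNReal.ofReal_mul (by positivity), hTn, hT0]
  · have := continuous_toLp_norm (n := n)
    fun_prop

/-- Scaling of the integral of a homogeneous function over a Euclidean ball. -/
theorem lintegral_ball_homogeneous {Φ : (Fin n → ℂ) → ENNReal} (hΦ : Measurable Φ) {J : ℕ}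
    (hom : ∀ r : ℝ, 0 < r → ∀ s, Φ (r • s) = ENNReal.ofReal (r ^ (2 * J)) * Φ s) {R : ℝ}
    (hR : 0 < R) :
    ∫⁻ s in {s : Fin n → ℂ | ‖WithLp.toLp 2 s‖ < R}, Φ s =
      ENNReal.ofReal (R ^ (2 * (J + n))) *
        ∫⁻ s in {s : Fin n → ℂ | ‖WithLp.toLp 2 s‖ < 1}, Φ s := by
  have hS : MeasurableSet {s : Fin n → ℂ | ‖WithLp.toLp 2 s‖ < R} :=
    (isOpen_lt continuous_toLp_norm continuous_const).measurableSet
  have hm : Measurable fun s : Fin n → ℂ => R • s := by fun_prop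
  have h1 := setLIntegral_map (μ := (volume : Measure (Fin n → ℂ))) hS hΦ hm
  rw [Measure.map_addHaar_smul _ hR.ne', Measure.restrict_smul, lintegral_smul_measure] at h1
  have hpre : (fun s : Fin n → ℂ => R • s) ⁻¹' {s | ‖WithLp.toLp 2 s‖ < R} =
      {s | ‖WithLp.toLp 2 s‖ < 1} := by
    ext s
    simp only [Set.mem_preimage, Set.mem_ofPred_eq, WithLp.toLp_smul, norm_smul, Real.norm_eq_abs,
      abs_of_pos hR]
    exact mul_lt_iff_lt_one_right hR
  rw [hpre] at h1
  simp_rw [hom R hR] at h1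
  rw [lintegral_const_mul _ hΦ, finrank_real_of_complex, Module.finrank_fintype_fun_eq_card,
    Fintype.card_fin, smul_eq_mul, abs_of_pos (by positivity)] at h1
  have h2 : ENNReal.ofReal (R ^ (2 * n)) * ENNReal.ofReal ((R ^ (2 * n))⁻¹) = 1 := by
    rw [← ENNReal.ofReal_mul (by positivity), mul_inv_cancel₀ (by positivity), ENNReal.ofReal_one]
  rw [mul_add, pow_add, mul_comm (R ^ (2 * J)), ENNReal.ofReal_mul (by positivity), mul_assoc, ← h1,
    ← mul_assoc, h2, one_mul]

theorem lintegral_exp_neg_Ioi (c : ℝ) :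
    ∫⁻ r in Set.Ioi c, ENNReal.ofReal (Real.exp (-r)) = ENNReal.ofReal (Real.exp (-c)) := by
  rw [← ofReal_integral_eq_lintegral_ofReal (integrableOn_exp_neg_Ioi c)
    (Filter.Eventually.of_forall fun _ => (Real.exp_pos _).le), integral_exp_neg_Ioi]

theorem lintegral_exp_neg_mul_pow (N : ℕ) :
    ∫⁻ r in Set.Ioi (0 : ℝ), ENNReal.ofReal (Real.exp (-r)) * ENNReal.ofReal (r ^ N) =
      ENNReal.ofReal N.factorial := by
  have hN : (0 : ℝ) < N + 1 := by positivity
  rw [← Real.Gamma_nat_eq_factorial, Real.Gamma_eq_integral hN,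
    ofReal_integral_eq_lintegral_ofReal (Real.GammaIntegral_convergent hN)]
  · refine setLIntegral_congr_fun measurableSet_Ioi fun r hr => ?_
    simp only [add_sub_cancel_right, Real.rpow_natCast]
    rw [ENNReal.ofReal_mul (Real.exp_pos _).le]
  · refine (ae_restrict_iff' measurableSet_Ioi).2 (Filter.Eventually.of_forall fun r hr => ?_)
    have : (0 : ℝ) < r := hr
    positivity

/-- Layer cake: the Gaussian integral of a homogeneous function in terms of its integral over
the unit ball. -/
theorem lintegral_homogeneous_mul_exp {Φ : (Fin n → ℂ) → ENNReal} (hΦ : Measurable Φ) {J : ℕ}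
    (hom : ∀ r : ℝ, 0 < r → ∀ s, Φ (r • s) = ENNReal.ofReal (r ^ (2 * J)) * Φ s) :
    ∫⁻ s, Φ s * ENNReal.ofReal (Real.exp (-‖WithLp.toLp 2 s‖ ^ 2)) =
      ENNReal.ofReal (J + n).factorial * ∫⁻ s in {s : Fin n → ℂ | ‖WithLp.toLp 2 s‖ < 1}, Φ s := by
  have hc := continuous_toLp_norm (n := n)
  set F : (Fin n → ℂ) → ℝ → ENNReal := fun s r =>
    {q : (Fin n → ℂ) × ℝ | ‖WithLp.toLp 2 q.1‖ ^ 2 < q.2}.indicator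
      (fun q => Φ q.1 * ENNReal.ofReal (Real.exp (-q.2))) (s, r) with hF
  have hset : MeasurableSet {q : (Fin n → ℂ) × ℝ | ‖WithLp.toLp 2 q.1‖ ^ 2 < q.2} :=
    (isOpen_lt ((hc.comp continuous_fst).pow 2) continuous_snd).measurableSet
  have hFm : Measurable (Function.uncurry F) := by
    refine Measurable.indicator ?_ hset
    exact (hΦ.comp measurable_fst).mul (by fun_prop)
  have h1 : ∀ s, Φ s * ENNReal.ofReal (Real.exp (-‖WithLp.toLp 2 s‖ ^ 2)) = ∫⁻ r, F s r := by
    intro s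
    rw [← lintegral_exp_neg_Ioi, ← lintegral_const_mul _ (by fun_prop),
      ← lintegral_indicator measurableSet_Ioi]
    rfl
  simp_rw [h1]
  rw [lintegral_lintegral_swap hFm.aemeasurable, ← lintegral_exp_neg_mul_pow,
    ← lintegral_mul_const _ (by fun_prop), ← lintegral_indicator measurableSet_Ioi]
  refine lintegral_congr fun r => ?_
  by_cases hr : 0 < r
  · rw [Set.indicator_of_mem (show r ∈ Set.Ioi 0 from hr)]
    have hs : ∀ s : Fin n → ℂ, ‖WithLp.toLp 2 s‖ ^ 2 < r ↔ ‖WithLp.toLp 2 s‖ < √r :=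
      fun s => (Real.lt_sqrt (norm_nonneg _)).symm
    have e : ∫⁻ s, F s r = ∫⁻ s in {s : Fin n → ℂ | ‖WithLp.toLp 2 s‖ < √r},
        Φ s * ENNReal.ofReal (Real.exp (-r)) := by
      rw [← lintegral_indicator (isOpen_lt hc continuous_const).measurableSet]
      refine lintegral_congr fun s => ?_
      simp only [hF, Set.indicator, Set.mem_ofPred_eq, hs]
    rw [e, lintegral_mul_const _ hΦ, lintegral_ball_homogeneous hΦ hom (Real.sqrt_pos.2 hr),
      pow_mul, Real.sq_sqrt hr.le]
    ring
  · rw [Set.indicator_of_notMem (show r ∉ Set.Ioi 0 from hr)]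
    have : ∀ s, F s r = 0 := by
      intro s
      refine Set.indicator_of_notMem (fun h => hr ?_) _
      exact lt_of_le_of_lt (sq_nonneg _) h
    simp [this]

theorem measurable_norm_herm_pow (u : Fin n → ℂ) (N : ℕ) :
    Measurable fun s : Fin n → ℂ => ENNReal.ofReal (‖herm s u‖ ^ (2 * N)) := by
  have := continuous_herm_left u
  fun_prop

theorem norm_herm_pow_smul (u : Fin n → ℂ) (N : ℕ) {r : ℝ} (hr : 0 < r) (s : Fin n → ℂ) :
    ENNReal.ofReal (‖herm (r • s) u‖ ^ (2 * N)) =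
      ENNReal.ofReal (r ^ (2 * N)) * ENNReal.ofReal (‖herm s u‖ ^ (2 * N)) := by
  have h : r • s = (r : ℂ) • s := by ext i; simp
  rw [← ENNReal.ofReal_mul (by positivity), h, herm_smul, norm_mul, mul_pow, Complex.norm_real,
    Real.norm_eq_abs, abs_of_pos hr]

/-- The norms on the unit ball, recovered from Gaussian integrals, which are products. -/
theorem lintegral_ball_herm (hn : 1 ≤ n) {u : Fin n → ℂ} (hu : ‖WithLp.toLp 2 u‖ = 1) (N : ℕ) :
    ∫⁻ s in {s : Fin n → ℂ | ‖WithLp.toLp 2 s‖ < 1}, ENNReal.ofReal (‖herm s u‖ ^ (2 * N)) =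
      ENNReal.ofReal (Real.pi ^ n * N.factorial / (N + n).factorial) := by
  have h := lintegral_homogeneous_mul_exp (measurable_norm_herm_pow u N)
    (fun r hr s => norm_herm_pow_smul u N hr s)
  rw [lintegral_gaussian_herm hn hu] at h
  have hf : (0 : ℝ) < (N + n).factorial := by positivity
  rw [ENNReal.ofReal_div_of_pos hf, ENNReal.eq_div_iff (by simpa using hf.ne') (by simp), h]

theorem lintegral_punctured_disc (p : ℝ) :
    ∫⁻ t in {t : ℂ | 0 < ‖t‖ ∧ ‖t‖ < 1}, ENNReal.ofReal (‖t‖ ^ p) =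
      if -2 < p then ENNReal.ofReal (2 * Real.pi / (p + 2)) else ⊤ := by
  have hset : MeasurableSet {t : ℂ | 0 < ‖t‖ ∧ ‖t‖ < 1} :=
    ((isOpen_lt continuous_const continuous_norm).inter
      (isOpen_lt continuous_norm continuous_const)).measurableSet
  have hmeas : Measurable fun r : ℝ => ENNReal.ofReal r *
      (Set.Ioo (0 : ℝ) 1).indicator (fun r => ENNReal.ofReal (r ^ p)) r :=
    ENNReal.measurable_ofReal.mul (Measurable.indicator (by fun_prop) measurableSet_Ioo)
  rw [← lintegral_indicator hset, ← Complex.lintegral_comp_polarCoord_symm]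
  have h1 : ∫⁻ q : ℝ × ℝ in polarCoord.target, ENNReal.ofReal q.1 •
        ({t : ℂ | 0 < ‖t‖ ∧ ‖t‖ < 1}.indicator (fun t => ENNReal.ofReal (‖t‖ ^ p))
          (Complex.polarCoord.symm q)) =
      ∫⁻ q : ℝ × ℝ in Set.Ioi 0 ×ˢ Set.Ioo (-Real.pi) Real.pi,
        (ENNReal.ofReal q.1 * (Set.Ioo (0 : ℝ) 1).indicator (fun r => ENNReal.ofReal (r ^ p)) q.1) *
          1 := by
    rw [polarCoord_target]
    refine setLIntegral_congr_fun (measurableSet_Ioi.prod measurableSet_Ioo) fun q hq => ?_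
    have hq0 : 0 < q.1 := hq.1
    simp only [Set.indicator, Set.mem_ofPred_eq, Complex.norm_polarCoord_symm, abs_of_pos hq0,
      Set.mem_Ioo, smul_eq_mul, mul_one]
  rw [h1, Measure.volume_eq_prod, ← Measure.prod_restrict,
    lintegral_prod_mul hmeas.aemeasurable aemeasurable_const]
  rw [setLIntegral_one, Real.volume_Ioo]
  have h2 : ∫⁻ r in Set.Ioi (0 : ℝ), ENNReal.ofReal r *
      (Set.Ioo (0 : ℝ) 1).indicator (fun r => ENNReal.ofReal (r ^ p)) r =
      ∫⁻ r in Set.Ioo (0 : ℝ) 1, ENNReal.ofReal (r ^ (p + 1)) := by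
    rw [← lintegral_indicator measurableSet_Ioi, ← lintegral_indicator measurableSet_Ioo]
    refine lintegral_congr fun r => ?_
    by_cases hr : r ∈ Set.Ioo (0 : ℝ) 1
    · rw [Set.indicator_of_mem hr, Set.indicator_of_mem (show r ∈ Set.Ioi 0 from hr.1),
        Set.indicator_of_mem hr, ← ENNReal.ofReal_mul hr.1.le, Real.rpow_add_one hr.1.ne', mul_comm]
    · rw [Set.indicator_of_notMem hr]
      by_cases h0 : r ∈ Set.Ioi (0 : ℝ)
      · rw [Set.indicator_of_mem h0, Set.indicator_of_notMem hr, mul_zero]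
      · rw [Set.indicator_of_notMem h0]
  rw [h2]
  have hnn : 0 ≤ᵐ[volume.restrict (Set.Ioo (0 : ℝ) 1)] fun r => r ^ (p + 1) :=
    (ae_restrict_iff' measurableSet_Ioo).2
      (Filter.Eventually.of_forall fun r hr => Real.rpow_nonneg hr.1.le _)
  have hiff := intervalIntegral.integrableOn_Ioo_rpow_iff (s := p + 1) (t := 1) one_pos
  split_ifs with hp
  · have hint := hiff.2 (by linarith)
    rw [← ofReal_integral_eq_lintegral_ofReal hint hnn, ← ENNReal.ofReal_mul
      (integral_nonneg_of_ae hnn), ← integral_Ioc_eq_integral_Ioo,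
      ← intervalIntegral.integral_of_le zero_le_one, integral_rpow (Or.inl (by linarith))]
    congr 1
    rw [Real.zero_rpow (by linarith), Real.one_rpow]
    have : p + 1 + 1 ≠ 0 := by linarith
    have : p + 2 ≠ 0 := by linarith
    field_simp
    ring
  · have hnint : ¬ IntegrableOn (fun x : ℝ => x ^ (p + 1)) (Set.Ioo 0 1) := by
      rw [hiff]
      linarith
    have : ∫⁻ r in Set.Ioo (0 : ℝ) 1, ENNReal.ofReal (r ^ (p + 1)) = ⊤ := by
      by_contra hcon
      apply hnint
      refine ⟨by fun_prop, ?_⟩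
      rw [hasFiniteIntegral_iff_ofReal hnn]
      exact lt_top_iff_ne_top.2 hcon
    rw [this, ENNReal.top_mul]
    simp [Real.pi_pos]

/-- Integration over the Hartogs triangle of a homogeneous function of `z` times a power of `|w|`,
by integrating first over the ball `|z| < |w| ^ (1 / k)`. -/
theorem lintegral_hartogs_homogeneous (hk : 1 ≤ k) {Φ : (Fin n → ℂ) → ENNReal} (hΦ : Measurable Φ)
    {J : ℕ} (hom : ∀ r : ℝ, 0 < r → ∀ s, Φ (r • s) = ENNReal.ofReal (r ^ (2 * J)) * Φ s) (m : ℤ) :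
    ∫⁻ p in hartogsTriangle n k, Φ p.1 * ENNReal.ofReal (‖p.2‖ ^ (2 * m)) =
      (∫⁻ s in {s : Fin n → ℂ | ‖WithLp.toLp 2 s‖ < 1}, Φ s) *
        if 0 < (k * (m + 1) + J + n : ℤ)
          then ENNReal.ofReal (Real.pi * k / (k * (m + 1) + J + n : ℤ)) else ⊤ := by
  have hc := continuous_toLp_norm (n := n)
  have hk0 : (0 : ℝ) < k := by exact_mod_cast hk
  set Q := ∫⁻ s in {s : Fin n → ℂ | ‖WithLp.toLp 2 s‖ < 1}, Φ s with hQ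
  have hzm : Measurable fun t : ℂ => ENNReal.ofReal (‖t‖ ^ (2 * m)) := by fun_prop
  have hΨ : Measurable fun p : (Fin n → ℂ) × ℂ => Φ p.1 * ENNReal.ofReal (‖p.2‖ ^ (2 * m)) :=
    (hΦ.comp measurable_fst).mul (hzm.comp measurable_snd)
  rw [← lintegral_indicator measurableSet_hartogsTriangle, Measure.volume_eq_prod,
    lintegral_prod_symm _ (hΨ.indicator measurableSet_hartogsTriangle).aemeasurable]
  have hset : MeasurableSet {t : ℂ | 0 < ‖t‖ ∧ ‖t‖ < 1} :=
    ((isOpen_lt continuous_const continuous_norm).inter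
      (isOpen_lt continuous_norm continuous_const)).measurableSet
  set p : ℝ := 2 * m + 2 * (J + n) / k with hp
  have hpm : Measurable fun t : ℂ => ENNReal.ofReal (‖t‖ ^ p) := by fun_prop
  have hiff : (-2 < p) ↔ 0 < (k * (m + 1) + J + n : ℤ) := by
    have e : p = 2 * ((k * (m + 1) + J + n : ℤ) : ℝ) / k - 2 := by
      rw [hp]; push_cast; field_simp; ring
    rw [e, ← Int.cast_pos (R := ℝ)]
    constructor
    · intro h
      have h' : 0 < 2 * ((k * (m + 1) + J + n : ℤ) : ℝ) / k := by linarith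
      have := (div_pos_iff_of_pos_right hk0).1 h'
      linarith
    · intro h
      have : 0 < 2 * ((k * (m + 1) + J + n : ℤ) : ℝ) / k := by positivity
      linarith
  have hval : (if 0 < (k * (m + 1) + J + n : ℤ)
          then ENNReal.ofReal (Real.pi * k / (k * (m + 1) + J + n : ℤ)) else ⊤) =
      ∫⁻ t in {t : ℂ | 0 < ‖t‖ ∧ ‖t‖ < 1}, ENNReal.ofReal (‖t‖ ^ p) := by
    rw [lintegral_punctured_disc]
    simp only [hiff]
    split_ifs with h
    · congr 1
      have h' : (0 : ℝ) < (k * (m + 1) + J + n : ℤ) := by exact_mod_cast h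
      have e : p + 2 = 2 * ((k * (m + 1) + J + n : ℤ) : ℝ) / k := by
        rw [hp]; push_cast; field_simp; ring
      rw [e]
      field_simp
    · rfl
  rw [hval, ← lintegral_const_mul _ hpm, ← lintegral_indicator hset]
  refine lintegral_congr fun t => ?_
  by_cases ht : t ∈ {t : ℂ | 0 < ‖t‖ ∧ ‖t‖ < 1}
  · rw [Set.indicator_of_mem ht]
    have ht0 : 0 < ‖t‖ := ht.1
    set R : ℝ := ‖t‖ ^ (1 / k : ℝ) with hR
    have hR0 : 0 < R := by positivity
    have hRk : R ^ k = ‖t‖ := by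
      rw [hR, ← Real.rpow_natCast, ← Real.rpow_mul ht0.le, one_div_mul_cancel hk0.ne',
        Real.rpow_one]
    have e : ∀ s : Fin n → ℂ, (hartogsTriangle n k).indicator
        (fun p => Φ p.1 * ENNReal.ofReal (‖p.2‖ ^ (2 * m))) (s, t) =
        {s : Fin n → ℂ | ‖WithLp.toLp 2 s‖ < R}.indicator
          (fun s => Φ s * ENNReal.ofReal (‖t‖ ^ (2 * m))) s := by
      intro s
      have : ((s, t) ∈ hartogsTriangle n k) ↔ ‖WithLp.toLp 2 s‖ < R := by
        rw [← pow_lt_pow_iff_left₀ (norm_nonneg _) hR0.le (by omega : k ≠ 0), hRk]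
        exact ⟨fun h => h.1, fun h => ⟨h, ht.2⟩⟩
      simp only [Set.indicator, this, Set.mem_ofPred_eq]
    simp_rw [e]
    rw [lintegral_indicator (isOpen_lt hc continuous_const).measurableSet,
      lintegral_mul_const _ hΦ, lintegral_ball_homogeneous hΦ hom hR0, ← hQ, mul_comm _ Q,
      mul_assoc,
      ← ENNReal.ofReal_mul (by positivity)]
    congr 2
    rw [hR, ← Real.rpow_natCast, ← Real.rpow_mul ht0.le, ← Real.rpow_intCast,
      ← Real.rpow_add ht0, hp]
    congr 1
    push_cast
    field_simp
    ring
  · rw [Set.indicator_of_notMem ht]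
    have : ∀ s : Fin n → ℂ, (hartogsTriangle n k).indicator
        (fun p => Φ p.1 * ENNReal.ofReal (‖p.2‖ ^ (2 * m))) (s, t) = 0 := by
      intro s
      refine Set.indicator_of_notMem (fun h => ht ?_) _
      exact ⟨norm_pos_iff.2 (snd_ne_zero_of_mem h), h.2⟩
    simp [this]

/-- The squared norm of `⟨z, u⟩ ^ N * w ^ m` in `L²` of the Hartogs triangle. It is infinite when
the weight is zero. -/
theorem lintegral_monomial (hn : 1 ≤ n) (hk : 1 ≤ k) {u : Fin n → ℂ} (hu : ‖WithLp.toLp 2 u‖ = 1)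
    (N : ℕ) (m : ℤ) :
    ∫⁻ p in hartogsTriangle n k, ENNReal.ofReal (‖herm p.1 u‖ ^ (2 * N)) *
        ENNReal.ofReal (‖p.2‖ ^ (2 * m)) = (ENNReal.ofReal (kernelWeight n k N m))⁻¹ := by
  rw [lintegral_hartogs_homogeneous hk (measurable_norm_herm_pow u N)
    (fun r hr s => norm_herm_pow_smul u N hr s), lintegral_ball_herm hn hu]
  have hk0 : (0 : ℝ) < k := by exact_mod_cast hk
  split_ifs with h
  · have h' : (0 : ℝ) < (k * (m + 1) + N + n : ℤ) := by exact_mod_cast h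
    have e : (((k * (m + 1) + N + n : ℤ).toNat : ℕ) : ℝ) = (k * (m + 1) + N + n : ℤ) := by
      have : (((k * (m + 1) + N + n : ℤ).toNat : ℕ) : ℤ) = (k * (m + 1) + N + n : ℤ) := by omega
      exact_mod_cast congrArg (Int.cast (R := ℝ)) this
    have hw : 0 < kernelWeight n k N m := by
      rw [kernelWeight, e]
      have : 0 < (N + n).choose n := Nat.choose_pos (by omega)
      positivity
    rw [← ENNReal.ofReal_mul (by positivity), ← ENNReal.ofReal_inv_of_pos hw]
    congr 1
    rw [kernelWeight, e]
    generalize ((k * (m + 1) + N + n : ℤ) : ℝ) = D at h'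
    have hch : ((N + n).factorial : ℝ) = (N + n).choose n * n.factorial * N.factorial := by
      have := Nat.add_choose_mul_factorial_mul_factorial N n
      rw [← this]
      push_cast
      ring
    have : (0 : ℝ) < (N + n).choose n := by exact_mod_cast Nat.choose_pos (by omega)
    rw [hch]
    field_simp
    ring
  · have : (k * (m + 1) + N + n : ℤ).toNat = 0 := by omega
    rw [kernelWeight, this, ENNReal.mul_top]
    · simp
    · rw [ne_eq, ENNReal.ofReal_eq_zero, not_le]
      positivity

/-! ### One complex variable: parametric integrals, Taylor and Laurent expansions -/

section ParametricIntegral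

/-- An integral of functions that are holomorphic in a parameter is holomorphic in the parameter,
provided the integrand has locally uniform integrable bounds. The bounds on the derivatives needed
to differentiate under the integral come from the Schwarz lemma. -/
theorem differentiableOn_integral_of_dominated {X Y : Type*} [NormedAddCommGroup X]
    [NormedSpace ℂ X] [FiniteDimensional ℂ X] [MeasurableSpace Y] {μ : Measure Y} {U : Set X}
    (hU : IsOpen U) {F : X → Y → ℂ} (hdiff : ∀ᵐ y ∂μ, DifferentiableOn ℂ (fun x => F x y) U)
    (hmeas : ∀ x ∈ U, AEStronglyMeasurable (F x) μ)
    (hbound : ∀ x₀ ∈ U, ∃ V ∈ nhds x₀, ∃ G : Y → ℝ, Integrable G μ ∧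
      ∀ᵐ y ∂μ, ∀ x ∈ V, ‖F x y‖ ≤ G y) :
    DifferentiableOn ℂ (fun x => ∫ y, F x y ∂μ) U := by
  intro x₀ hx₀
  obtain ⟨V, hV, G, hG, hFG⟩ := hbound x₀ hx₀
  obtain ⟨ε, hε, hball⟩ := Metric.mem_nhds_iff.1 (Filter.inter_mem hV (hU.mem_nhds hx₀))
  have hε2 : 0 < ε / 2 := by positivity
  have hsub : ∀ x ∈ Metric.ball x₀ (ε / 2), Metric.ball x (ε / 2) ⊆ V ∩ U := by
    intro x hx y hy
    apply hball
    rw [Metric.mem_ball] at *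
    linarith [dist_triangle y x x₀]
  have hder : ∀ᵐ y ∂μ, ∀ x ∈ Metric.ball x₀ (ε / 2),
      HasFDerivAt (fun x => F x y) (fderiv ℂ (fun x => F x y) x) x := by
    filter_upwards [hdiff] with y hy x hx
    have hxU : x ∈ U := (hsub x hx (Metric.mem_ball_self hε2)).2
    exact (hy.differentiableAt (hU.mem_nhds hxU)).hasFDerivAt
  have hx₀b : x₀ ∈ Metric.ball x₀ (ε / 2) := Metric.mem_ball_self hε2
  have hFint : Integrable (F x₀) μ := by
    refine hG.mono' (hmeas x₀ hx₀) ?_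
    filter_upwards [hFG] with y hy using hy x₀ (mem_of_mem_nhds hV)
  refine (hasFDerivAt_integral_of_dominated_of_fderiv_le (𝕜 := ℂ)
    (F' := fun x y => fderiv ℂ (fun x => F x y) x) (bound := fun y => 2 * G y / (ε / 2))
    (Metric.ball_mem_nhds x₀ hε2) ?_ hFint ?_ ?_ ?_ hder).differentiableAt.differentiableWithinAt
  · filter_upwards [hU.mem_nhds hx₀] with x hx using hmeas x hx
  · -- In a basis, the derivative is a sum of limits of difference quotients.
    let b := Module.finBasis ℂ X
    have hsum : (fun y => fderiv ℂ (fun x => F x y) x₀) = fun y =>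
        ∑ i, (fderiv ℂ (fun x => F x y) x₀ (b i)) •
          LinearMap.toContinuousLinearMap (b.coord i) := by
      ext y v
      conv_lhs => rw [← b.sum_repr v, map_sum]
      simp [-Module.Basis.sum_repr, mul_comm]
    rw [hsum]
    refine Finset.aestronglyMeasurable_fun_sum _ fun i _ => ?_
    refine AEStronglyMeasurable.smul_const ?_ _
    have hcm : Filter.Tendsto (fun j : ℕ => ‖((j : ℂ) + 1)‖) Filter.atTop Filter.atTop := by
      have : ∀ j : ℕ, ‖((j : ℂ) + 1)‖ = (j : ℝ) + 1 := fun j => by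
        exact_mod_cast Complex.norm_natCast (j + 1)
      simp_rw [this]
      exact Filter.tendsto_atTop_add_const_right _ _ tendsto_natCast_atTop_atTop
    have hlim : Filter.Tendsto (fun j : ℕ => x₀ + ((j : ℂ) + 1)⁻¹ • b i) Filter.atTop
        (nhds x₀) := by
      have h0 : Filter.Tendsto (fun j : ℕ => ((j : ℂ) + 1)⁻¹) Filter.atTop (nhds 0) :=
        Filter.tendsto_inv₀_cobounded.comp (tendsto_norm_atTop_iff_cobounded.1 hcm)
      simpa using (h0.smul_const (b i)).const_add x₀
    obtain ⟨j₀, hj₀⟩ := Filter.eventually_atTop.1 (hlim.eventually (hU.mem_nhds hx₀))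
    refine aestronglyMeasurable_of_tendsto_ae Filter.atTop
      (f := fun j y => (((j + j₀ : ℕ) : ℂ) + 1) •
        (F (x₀ + (((j + j₀ : ℕ) : ℂ) + 1)⁻¹ • b i) y - F x₀ y)) ?_ ?_
    · intro j
      have hd := (hmeas _ (hj₀ (j + j₀) (Nat.le_add_left _ _))).sub (hmeas _ hx₀)
      exact hd.const_smul (((j + j₀ : ℕ) : ℂ) + 1)
    · filter_upwards [hder] with y hy
      have := (hy x₀ hx₀b).lim (b i) hcm
      exact this.comp (Filter.tendsto_add_atTop_nat j₀)
  · filter_upwards [hdiff, hFG] with y hy hGy x hx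
    refine Complex.norm_fderiv_le_div_of_mapsTo_ball
      (hy.mono ((hsub x hx).trans Set.inter_subset_right)) ?_ hε2
    intro z hz
    have h1 := hGy z (hsub x hx hz).1
    have h2 := hGy x (hsub x hx (Metric.mem_ball_self hε2)).1
    rw [Metric.mem_closedBall, dist_eq_norm]
    linarith [norm_sub_le (F z y) (F x y)]
  · exact (hG.const_mul 2).div_const _

end ParametricIntegral

section Circle

/-- The point `exp (2 π i θ)` of the unit circle in `ℂ`. -/
noncomputable def unitPhase (θ : UnitAddCircle) : ℂ := (AddCircle.toCircle θ : ℂ)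

theorem norm_unitPhase (θ : UnitAddCircle) : ‖unitPhase θ‖ = 1 := Circle.norm_coe _

theorem unitPhase_ne_zero (θ : UnitAddCircle) : unitPhase θ ≠ 0 := Circle.coe_ne_zero _

theorem continuous_unitPhase : Continuous unitPhase :=
  continuous_subtype_val.comp AddCircle.continuous_toCircle

theorem unitPhase_add (θ η : UnitAddCircle) : unitPhase (θ + η) = unitPhase θ * unitPhase η := by
  simp [unitPhase, AddCircle.toCircle_add]

theorem unitPhase_zero : unitPhase 0 = 1 := by simp [unitPhase]

theorem fourier_eq_unitPhase_zpow (m : ℤ) (θ : UnitAddCircle) : fourier m θ = unitPhase θ ^ m := by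
  rw [fourier_apply, AddCircle.toCircle_zsmul]
  simp [unitPhase]

theorem exists_eq_norm_mul_unitPhase (ζ : ℂ) : ∃ θ, ζ = unitPhase θ * ‖ζ‖ := by
  refine ⟨((ζ.arg / (2 * Real.pi) : ℝ) : UnitAddCircle), ?_⟩
  rw [unitPhase, AddCircle.toCircle_apply_mk, Circle.coe_exp]
  conv_lhs => rw [← Complex.norm_mul_exp_arg_mul_I ζ]
  rw [mul_comm]
  congr 3
  have := Real.pi_ne_zero
  push_cast
  field_simp

theorem integral_unitPhase_mul_real (f : ℂ → ℂ) (r : ℝ) :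
    ∫ θ, f (unitPhase θ * r) ∂AddCircle.haarAddCircle = Real.circleAverage f 0 r := by
  have h := fourierCoeff_eq_intervalIntegral (fun θ : UnitAddCircle => f (unitPhase θ * r)) 0 0
  simp only [fourierCoeff, neg_zero, fourier_zero, one_smul, div_one, zero_add] at h
  rw [h, Real.circleAverage]
  have h2 := intervalIntegral.integral_comp_mul_left (a := 0) (b := 1) (c := 2 * Real.pi)
    (fun θ => f (circleMap 0 r θ)) (by positivity)
  rw [mul_zero, mul_one] at h2
  rw [← h2]
  refine intervalIntegral.integral_congr fun x _ => ?_
  simp only [unitPhase, AddCircle.toCircle_apply_mk, Circle.coe_exp, circleMap, zero_add]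
  rw [mul_comm]
  congr 3
  simp

/-- The average of `f` over the circle through `ζ` centred at the origin. -/
theorem integral_unitPhase_mul (f : ℂ → ℂ) (ζ : ℂ) :
    ∫ θ, f (unitPhase θ * ζ) ∂AddCircle.haarAddCircle = Real.circleAverage f 0 ‖ζ‖ := by
  obtain ⟨η, hη⟩ := exists_eq_norm_mul_unitPhase ζ
  rw [← integral_unitPhase_mul_real,
    ← integral_add_right_eq_self (fun θ : UnitAddCircle => f (unitPhase θ * (‖ζ‖ : ℝ))) η]
  congr 1
  ext θ
  rw [unitPhase_add, mul_assoc, ← hη]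

/-- Mean value property. -/
theorem integral_unitPhase_eq_center {f : ℂ → ℂ} {ζ : ℂ}
    (hf : DifferentiableOn ℂ f (Metric.closedBall 0 ‖ζ‖)) :
    ∫ θ, f (unitPhase θ * ζ) ∂AddCircle.haarAddCircle = f 0 := by
  rw [integral_unitPhase_mul]
  apply DiffContOnCl.circleAverage
  rw [abs_of_nonneg (norm_nonneg _)]
  exact (hf.mono Metric.closure_ball_subset_closedBall).diffContOnCl

theorem integrable_of_continuous_circle {f : UnitAddCircle → ℂ} (hf : Continuous f) :
    Integrable f AddCircle.haarAddCircle :=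
  hf.integrable_of_hasCompactSupport (HasCompactSupport.of_compactSpace f)

/-- The Taylor expansion of `f` on a disc, with its terms as Fourier coefficients on circles. -/
theorem exists_taylor {f : ℂ → ℂ} {R : ℝ} (hf : DifferentiableOn ℂ f (Metric.ball 0 R)) :
    ∃ c : ℕ → ℂ, ∀ σ : ℂ, ‖σ‖ < R → HasSum (fun N => c N * σ ^ N) (f σ) ∧
      ∀ N : ℕ, fourierCoeff (fun θ : UnitAddCircle => f (unitPhase θ * σ)) N = c N * σ ^ N := by
  have hsum : ∀ σ : ℂ, ‖σ‖ < R →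
      HasSum (fun N : ℕ => ((N.factorial : ℂ)⁻¹ * iteratedDeriv N f 0) * σ ^ N) (f σ) := by
    intro σ hσ
    have h := Complex.hasSum_taylorSeries_on_ball hf (z := σ) (by simpa using hσ)
    simp only [sub_zero, smul_eq_mul] at h
    refine h.congr_fun fun N => ?_
    ring
  refine ⟨fun N => (N.factorial : ℂ)⁻¹ * iteratedDeriv N f 0, fun σ hσ => ⟨hsum σ hσ, fun N => ?_⟩⟩
  set c : ℕ → ℂ := fun N => (N.factorial : ℂ)⁻¹ * iteratedDeriv N f 0 with hc
  have h1 : ∀ θ : UnitAddCircle, f (unitPhase θ * σ) =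
      ∑' j : ℕ, (c j * σ ^ j) * fourier (j : ℤ) θ := by
    intro θ
    have := hsum (unitPhase θ * σ) (by rwa [norm_mul, norm_unitPhase, one_mul])
    rw [← this.tsum_eq]
    refine tsum_congr fun j => ?_
    rw [fourier_eq_unitPhase_zpow, zpow_natCast, mul_pow]
    ring
  have h2 := hasSum_integral_of_summable_integral_norm (μ := AddCircle.haarAddCircle (T := 1))
    (F := fun (j : ℕ) θ => fourier (-(N : ℤ)) θ * ((c j * σ ^ j) * fourier (j : ℤ) θ)) (fun j => by
      apply integrable_of_continuous_circle
      fun_prop) (by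
      simp only [norm_mul, fourier_eq_unitPhase_zpow, norm_zpow, norm_unitPhase, one_zpow, mul_one,
        one_mul, integral_const]
      simpa [hc] using (hsum σ hσ).summable.norm)
  have h3 : ∀ j : ℕ, ∫ θ, fourier (-(N : ℤ)) θ * ((c j * σ ^ j) * fourier (j : ℤ) θ)
      ∂AddCircle.haarAddCircle (T := 1) = if j = N then c N * σ ^ N else 0 := by
    intro j
    have h := congrFun (fourierCoeff_fourier (T := 1) j) N
    have e : ∫ θ, fourier (-(N : ℤ)) θ * ((c j * σ ^ j) * fourier (j : ℤ) θ)
        ∂AddCircle.haarAddCircle (T := 1) =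
          (c j * σ ^ j) * fourierCoeff (fourier (T := 1) j) N := by
      rw [fourierCoeff, ← integral_const_mul]
      congr 1
      ext θ
      rw [smul_eq_mul]
      ring
    rw [e, h]
    by_cases hj : j = N
    · simp [hj]
    · rw [if_neg hj, Pi.single_eq_of_ne (by exact_mod_cast (Ne.symm hj)), mul_zero]
  simp_rw [h3, tsum_mul_left, ← h1] at h2
  rw [fourierCoeff]
  simp only [smul_eq_mul]
  rw [← h2.tsum_eq, tsum_ite_eq]

theorem norm_fourierCoeff_le {f : UnitAddCircle → ℂ} {M : ℝ} (hf : ∀ θ, ‖f θ‖ ≤ M) (m : ℤ) :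
    ‖fourierCoeff f m‖ ≤ M := by
  rw [fourierCoeff]
  refine (norm_integral_le_of_norm_le_const (C := M)
    (Filter.Eventually.of_forall fun θ => ?_)).trans (by simp)
  rw [norm_smul, fourier_eq_unitPhase_zpow, norm_zpow, norm_unitPhase, one_zpow, one_mul]
  exact hf θ

/-- The Laurent expansion of `f` on an annulus, with its terms as Fourier coefficients on
circles. -/
theorem exists_laurent {f : ℂ → ℂ} {r₁ r₂ : ℝ} (h₁ : 0 ≤ r₁)
    (hf : DifferentiableOn ℂ f {ζ | r₁ < ‖ζ‖ ∧ ‖ζ‖ < r₂}) :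
    ∃ c : ℤ → ℂ, ∀ ζ : ℂ, r₁ < ‖ζ‖ → ‖ζ‖ < r₂ → HasSum (fun m => c m * ζ ^ m) (f ζ) ∧
      ∀ m : ℤ, fourierCoeff (fun θ : UnitAddCircle => f (unitPhase θ * ζ)) m = c m * ζ ^ m := by
  have hopen : IsOpen {ζ : ℂ | r₁ < ‖ζ‖ ∧ ‖ζ‖ < r₂} :=
    (isOpen_lt continuous_const continuous_norm).inter (isOpen_lt continuous_norm continuous_const)
  set c : ℤ → ℂ := fun m => Real.circleAverage (fun z => z ^ (-m) * f z) 0 ((r₁ + r₂) / 2) with hc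
  have hdiff : ∀ m : ℤ, DifferentiableOn ℂ (fun z => z ^ (-m) * f z) {ζ | r₁ < ‖ζ‖ ∧ ‖ζ‖ < r₂} := by
    intro m
    refine DifferentiableOn.mul (fun z hz => ?_) hf
    exact (differentiableAt_zpow.2 (Or.inl
      (norm_pos_iff.1 (h₁.trans_lt hz.1)))).differentiableWithinAt
  have hmono : ∀ (m : ℤ) (r R : ℝ), r₁ < r → r ≤ R → R < r₂ →
      Real.circleAverage (fun z => z ^ (-m) * f z) 0 R =
        Real.circleAverage (fun z => z ^ (-m) * f z) 0 r := by
    intro m r R hr hrR hR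
    have hr0 : 0 < r := h₁.trans_lt hr
    rw [Real.circleAverage_eq_circleIntegral hr0.ne',
      Real.circleAverage_eq_circleIntegral (hr0.trans_le hrR).ne']
    congr 1
    refine Complex.circleIntegral_sub_center_inv_smul_eq_of_differentiable_on_annulus_off_countable
      hr0 hrR Set.countable_empty ?_ ?_
    · refine (hdiff m).continuousOn.mono fun z hz => ?_
      simp only [Set.mem_sdiff, Metric.mem_closedBall, dist_zero_right, Metric.mem_ball,
        not_lt] at hz
      exact ⟨hr.trans_le hz.2, hz.1.trans_lt hR⟩
    · intro z hz
      simp only [Set.mem_sdiff, Metric.mem_closedBall, dist_zero_right, Metric.mem_ball,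
        not_le] at hz
      exact (hdiff m).differentiableAt (hopen.mem_nhds ⟨hr.trans hz.1.2, hz.1.1.trans hR⟩)
  have hcr : ∀ (m : ℤ) (r : ℝ), r₁ < r → r < r₂ →
      Real.circleAverage (fun z => z ^ (-m) * f z) 0 r = c m := by
    intro m r hr hr2
    rcases le_total r ((r₁ + r₂) / 2) with h | h
    · exact (hmono m r _ hr h (by linarith)).symm
    · exact hmono m _ r (by linarith) h hr2
  have hcoef : ∀ ζ : ℂ, r₁ < ‖ζ‖ → ‖ζ‖ < r₂ → ∀ m : ℤ,
      fourierCoeff (fun θ : UnitAddCircle => f (unitPhase θ * ζ)) m = c m * ζ ^ m := by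
    intro ζ hζ1 hζ2 m
    have hζ0 : ζ ≠ 0 := norm_pos_iff.1 (h₁.trans_lt hζ1)
    rw [← hcr m _ hζ1 hζ2, ← integral_unitPhase_mul, fourierCoeff, mul_comm, ← integral_const_mul]
    congr 1
    ext θ
    have := unitPhase_ne_zero θ
    rw [smul_eq_mul, fourier_eq_unitPhase_zpow, mul_zpow, ← mul_assoc, zpow_neg ζ]
    field_simp
  have hcont : ∀ ζ : ℂ, r₁ < ‖ζ‖ → ‖ζ‖ < r₂ →
      Continuous fun θ : UnitAddCircle => f (unitPhase θ * ζ) := by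
    intro ζ hζ1 hζ2
    refine hf.continuousOn.comp_continuous (continuous_unitPhase.mul continuous_const) fun θ => ?_
    simpa [norm_unitPhase] using ⟨hζ1, hζ2⟩
  -- Cauchy estimates on the circle of radius `r`.
  have hbd : ∀ r : ℝ, r₁ < r → r < r₂ → ∃ M : ℝ, ∀ m : ℤ, ‖c m‖ * r ^ m ≤ M := by
    intro r hr hr2
    have hr0 : 0 < r := h₁.trans_lt hr
    have hn : ‖(r : ℂ)‖ = r := by rw [Complex.norm_real, Real.norm_eq_abs, abs_of_pos hr0]
    obtain ⟨M, hM⟩ := isCompact_univ.exists_bound_of_continuousOn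
      (hcont r (by rwa [hn]) (by rwa [hn])).continuousOn
    refine ⟨M, fun m => ?_⟩
    have := norm_fourierCoeff_le (fun θ => hM θ (Set.mem_univ θ)) m
    rwa [hcoef r (by rwa [hn]) (by rwa [hn]), norm_mul, norm_zpow, hn] at this
  refine ⟨c, fun ζ hζ1 hζ2 => ⟨?_, hcoef ζ hζ1 hζ2⟩⟩
  have hζ0 : 0 < ‖ζ‖ := h₁.trans_lt hζ1
  have hsummable : Summable fun m => c m * ζ ^ m := by
    obtain ⟨R, hR1, hR2⟩ := exists_between hζ2
    obtain ⟨r, hr1, hr2⟩ := exists_between hζ1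
    have hr0 : 0 < r := h₁.trans_lt hr1
    have hR0 : 0 < R := hζ0.trans hR1
    obtain ⟨M, hM⟩ := hbd R (hζ1.trans hR1) hR2
    obtain ⟨M', hM'⟩ := hbd r hr1 (hr2.trans hζ2)
    refine Summable.of_nat_of_neg ?_ ?_
    · refine Summable.of_norm_bounded (g := fun j : ℕ => M * (‖ζ‖ / R) ^ j)
        ((summable_geometric_of_lt_one (by positivity) ((div_lt_one hR0).2 hR1)).mul_left _) ?_
      intro j
      have h := hM j
      rw [zpow_natCast] at h
      rw [norm_mul, zpow_natCast, norm_pow]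
      calc ‖c j‖ * ‖ζ‖ ^ j = (‖c j‖ * R ^ j) * (‖ζ‖ / R) ^ j := by
            rw [div_pow]; field_simp
        _ ≤ _ := by gcongr
    · refine Summable.of_norm_bounded (g := fun j : ℕ => M' * (r / ‖ζ‖) ^ j)
        ((summable_geometric_of_lt_one (by positivity) ((div_lt_one hζ0).2 hr2)).mul_left _) ?_
      intro j
      have h := hM' (-j)
      rw [zpow_neg, zpow_natCast] at h
      rw [norm_mul, zpow_neg, zpow_natCast, norm_inv, norm_pow]
      calc ‖c (-j)‖ * (‖ζ‖ ^ j)⁻¹ = (‖c (-j)‖ * (r ^ j)⁻¹) * (r / ‖ζ‖) ^ j := by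
            rw [div_pow]; field_simp
        _ ≤ _ := by gcongr
  have hfc := hcoef ζ hζ1 hζ2
  have h := has_pointwise_sum_fourier_series_of_summable
    (f := ⟨fun θ : UnitAddCircle => f (unitPhase θ * ζ), hcont ζ hζ1 hζ2⟩)
    (by convert hsummable using 1; ext m; exact hfc m) 0
  simp only [ContinuousMap.coe_mk, hfc, fourier_eval_zero, smul_eq_mul, mul_one, unitPhase_zero,
    one_mul] at h
  exact h

end Circle

/-! ### Expansion on the Hartogs triangle in two variables -/

/-- Expansion of a holomorphic function on the Hartogs triangle in `ℂ²`: a Taylor series in the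
first variable whose coefficients are Laurent series in the second. Each monomial is also
a Fourier coefficient on a torus. -/
theorem exists_taylor_laurent (hk : 1 ≤ k) {H : ℂ → ℂ → ℂ}
    (hH : DifferentiableOn ℂ (fun q : ℂ × ℂ => H q.1 q.2) {q | ‖q.1‖ ^ k < ‖q.2‖ ∧ ‖q.2‖ < 1}) :
    ∃ d : ℕ → ℤ → ℂ, ∀ σ τ : ℂ, ‖σ‖ ^ k < ‖τ‖ → ‖τ‖ < 1 →
      (∀ (N : ℕ) (m : ℤ), fourierCoeff (fun θ : UnitAddCircle =>
        fourierCoeff (fun φ : UnitAddCircle => H (unitPhase φ * σ) (unitPhase θ * τ)) N) m =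
          d N m * σ ^ N * τ ^ m) ∧
      ∃ c : ℕ → ℂ, (∀ N, HasSum (fun m => d N m * σ ^ N * τ ^ m) (c N)) ∧ HasSum c (H σ τ) := by
  have hk0 : k ≠ 0 := by omega
  have hkR : (0 : ℝ) < k := by exact_mod_cast hk
  have hrad : ∀ (τ σ : ℂ), 0 < ‖τ‖ → (‖σ‖ < ‖τ‖ ^ (1 / k : ℝ) ↔ ‖σ‖ ^ k < ‖τ‖) := by
    intro τ σ hτ
    have h : (‖τ‖ ^ (1 / k : ℝ)) ^ k = ‖τ‖ := by
      rw [← Real.rpow_natCast, ← Real.rpow_mul hτ.le, one_div_mul_cancel hkR.ne', Real.rpow_one]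
    rw [← pow_lt_pow_iff_left₀ (norm_nonneg σ) (by positivity) hk0, h]
  have hT : ∀ τ : ℂ, ∃ c : ℕ → ℂ, 0 < ‖τ‖ → ‖τ‖ < 1 → ∀ σ : ℂ, ‖σ‖ ^ k < ‖τ‖ →
      HasSum (fun N => c N * σ ^ N) (H σ τ) ∧
      ∀ N : ℕ, fourierCoeff (fun θ : UnitAddCircle => H (unitPhase θ * σ) τ) N = c N * σ ^ N := by
    intro τ
    by_cases hτ : 0 < ‖τ‖ ∧ ‖τ‖ < 1
    · obtain ⟨c, hc⟩ := exists_taylor (f := fun σ => H σ τ) (R := ‖τ‖ ^ (1 / k : ℝ)) (by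
        refine hH.comp (f := fun σ : ℂ => (σ, τ)) (by fun_prop) fun σ hσ => ?_
        rw [Metric.mem_ball, dist_zero_right, hrad τ σ hτ.1] at hσ
        exact ⟨hσ, hτ.2⟩)
      exact ⟨c, fun _ _ σ hσ => hc σ ((hrad τ σ hτ.1).2 hσ)⟩
    · exact ⟨0, fun h1 h2 => absurd ⟨h1, h2⟩ hτ⟩
  choose c hc using hT
  have hcdiff : ∀ N, DifferentiableOn ℂ (fun τ => c τ N) {τ | 0 < ‖τ‖ ∧ ‖τ‖ < 1} := by
    intro N τ₀ hτ₀
    obtain ⟨δ, hδ0, hδ⟩ := exists_between hτ₀.1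
    -- On `|τ| > δ` the Taylor coefficient is an integral over a fixed circle.
    obtain ⟨r, hr0, hr⟩ : ∃ r : ℝ, 0 < r ∧ r ^ k < δ := by
      refine ⟨(δ / 2) ^ (1 / k : ℝ), by positivity, ?_⟩
      rw [← Real.rpow_natCast, ← Real.rpow_mul (by positivity), one_div_mul_cancel hkR.ne',
        Real.rpow_one]
      linarith
    have hrn : ‖(r : ℂ)‖ = r := by rw [Complex.norm_real, Real.norm_eq_abs, abs_of_pos hr0]
    have hU : IsOpen {τ : ℂ | δ < ‖τ‖ ∧ ‖τ‖ < 1} :=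
      (isOpen_lt continuous_const continuous_norm).inter
        (isOpen_lt continuous_norm continuous_const)
    have hmem : ∀ (φ : UnitAddCircle) (τ : ℂ), τ ∈ {τ : ℂ | δ < ‖τ‖ ∧ ‖τ‖ < 1} →
        (unitPhase φ * r, τ) ∈ {q : ℂ × ℂ | ‖q.1‖ ^ k < ‖q.2‖ ∧ ‖q.2‖ < 1} := by
      intro φ τ hτ
      refine ⟨?_, hτ.2⟩
      simp only [norm_mul, norm_unitPhase, one_mul, hrn]
      exact hr.trans hτ.1
    have hd : DifferentiableOn ℂ (fun τ => ∫ φ, fourier (-(N : ℤ)) φ * H (unitPhase φ * r) τ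
        ∂AddCircle.haarAddCircle (T := 1)) {τ | δ < ‖τ‖ ∧ ‖τ‖ < 1} := by
      have hcont : ContinuousOn (fun q : UnitAddCircle × ℂ =>
          fourier (-(N : ℤ)) q.1 * H (unitPhase q.1 * r) q.2)
          (Set.univ ×ˢ {τ | δ < ‖τ‖ ∧ ‖τ‖ < 1}) := by
        have hu := continuous_unitPhase
        refine ContinuousOn.mul (by fun_prop) (hH.continuousOn.comp
          (f := fun q : UnitAddCircle × ℂ => (unitPhase q.1 * r, q.2)) (by fun_prop) ?_)
        intro q hq
        exact hmem q.1 q.2 hq.2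
      refine differentiableOn_integral_of_dominated hU
        (Filter.Eventually.of_forall fun φ => ?_) ?_ ?_
      · refine DifferentiableOn.const_mul ?_ _
        exact hH.comp (f := fun τ : ℂ => (unitPhase φ * r, τ)) (by fun_prop)
          fun τ hτ => hmem φ τ hτ
      · intro τ hτ
        have : Continuous fun φ : UnitAddCircle =>
            fourier (-(N : ℤ)) φ * H (unitPhase φ * r) τ :=
          hcont.comp_continuous (f := fun φ : UnitAddCircle => (φ, τ)) (by fun_prop)
            fun φ => ⟨Set.mem_univ _, hτ⟩
        exact this.aestronglyMeasurable
      · intro τ₁ hτ₁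
        obtain ⟨ε, hε, hball⟩ := Metric.isOpen_iff.1 hU τ₁ hτ₁
        have hsub : Metric.closedBall τ₁ (ε / 2) ⊆ {τ : ℂ | δ < ‖τ‖ ∧ ‖τ‖ < 1} :=
          (Metric.closedBall_subset_ball (by linarith)).trans hball
        obtain ⟨M, hM⟩ := (isCompact_univ.prod
          (isCompact_closedBall τ₁ (ε / 2))).exists_bound_of_continuousOn
            (hcont.mono (Set.prod_mono_right hsub))
        refine ⟨_, Metric.closedBall_mem_nhds τ₁ (half_pos hε), fun _ => M, integrable_const _, ?_⟩
        exact Filter.Eventually.of_forall fun φ τ hτ => hM (φ, τ) ⟨Set.mem_univ _, hτ⟩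
    have hτ₀U : τ₀ ∈ {τ : ℂ | δ < ‖τ‖ ∧ ‖τ‖ < 1} := ⟨hδ, hτ₀.2⟩
    have heq : ∀ τ ∈ {τ : ℂ | δ < ‖τ‖ ∧ ‖τ‖ < 1}, c τ N =
        (∫ φ, fourier (-(N : ℤ)) φ * H (unitPhase φ * r) τ ∂AddCircle.haarAddCircle (T := 1)) /
          (r : ℂ) ^ N := by
      intro τ hτ
      have h := (hc τ (hδ0.trans hτ.1) hτ.2 r (by rw [hrn]; exact hr.trans hτ.1)).2 N
      rw [fourierCoeff] at h
      simp only [smul_eq_mul] at h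
      rw [h, mul_div_cancel_right₀]
      exact pow_ne_zero _ (by exact_mod_cast hr0.ne')
    have h2 := (hd.div_const ((r : ℂ) ^ N)).congr heq
    exact (h2.differentiableAt (hU.mem_nhds hτ₀U)).differentiableWithinAt
  have hL := fun N => exists_laurent le_rfl (hcdiff N)
  choose d hd using hL
  refine ⟨d, fun σ τ hσ hτ => ?_⟩
  have hτ0 : 0 < ‖τ‖ := lt_of_le_of_lt (by positivity) hσ
  refine ⟨fun N m => ?_, fun N => c τ N * σ ^ N, fun N => ?_, (hc τ hτ0 hτ σ hσ).1⟩
  · have e : ∀ θ : UnitAddCircle,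
        fourierCoeff (fun φ : UnitAddCircle => H (unitPhase φ * σ) (unitPhase θ * τ)) N =
          σ ^ N * c (unitPhase θ * τ) N := by
      intro θ
      have hn : ‖unitPhase θ * τ‖ = ‖τ‖ := by rw [norm_mul, norm_unitPhase, one_mul]
      rw [(hc (unitPhase θ * τ) (by rwa [hn]) (by rwa [hn]) σ (by rwa [hn])).2 N, mul_comm]
    simp_rw [e]
    rw [fourierCoeff.const_mul, (hd N τ hτ0 hτ).2 m]
    ring
  · have h := (hd N τ hτ0 hτ).1.mul_left (σ ^ N)
    rw [mul_comm] at h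
    exact h.congr_fun fun m => by ring

/-! ### Inner products with monomials, by averaging over a torus -/

/-- Haar probability measure of the three-dimensional torus. -/
noncomputable abbrev torusHaar : Measure (UnitAddCircle × UnitAddCircle × UnitAddCircle) :=
  AddCircle.haarAddCircle.prod (AddCircle.haarAddCircle.prod AddCircle.haarAddCircle)

/-- The action of the torus through `torusAct`; the parameters rotate, in this order, the last
coordinate, the vector `z`, and the part of `z` orthogonal to `u`. -/
noncomputable def torusRot (u : Fin n → ℂ) (g : UnitAddCircle × UnitAddCircle × UnitAddCircle)
    (p : (Fin n → ℂ) × ℂ) : (Fin n → ℂ) × ℂ :=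
  torusAct u (unitPhase g.2.1) (unitPhase g.2.2) (unitPhase g.1) p

theorem continuous_torusRot (u : Fin n → ℂ) : Continuous (Function.uncurry (torusRot u)) := by
  have h1 := continuous_herm_left u
  have h2 := continuous_unitPhase
  unfold torusRot torusAct Function.uncurry
  have h3 : Continuous fun q : (UnitAddCircle × UnitAddCircle × UnitAddCircle) × (Fin n → ℂ) × ℂ =>
    herm q.2.1 u := h1.comp (by fun_prop)
  fun_prop

theorem measurePreserving_torusRot {u : Fin n → ℂ} (hu : ‖WithLp.toLp 2 u‖ = 1)
    (g : UnitAddCircle × UnitAddCircle × UnitAddCircle) :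
    MeasurePreserving (torusRot u g) (volume.restrict (hartogsTriangle n k))
      (volume.restrict (hartogsTriangle n k)) :=
  measurePreserving_torusAct hu (norm_unitPhase _) (norm_unitPhase _) (norm_unitPhase _)

theorem torusRot_mem {u : Fin n → ℂ} (hu : ‖WithLp.toLp 2 u‖ = 1)
    (g : UnitAddCircle × UnitAddCircle × UnitAddCircle) {p : (Fin n → ℂ) × ℂ}
    (hp : p ∈ hartogsTriangle n k) : torusRot u g p ∈ hartogsTriangle n k :=
  (torusAct_mem_iff hu (norm_unitPhase _) (norm_unitPhase _) (norm_unitPhase _) p).2 hp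

theorem norm_toLp_smul {u : Fin n → ℂ} (hu : ‖WithLp.toLp 2 u‖ = 1) (σ : ℂ) :
    ‖WithLp.toLp 2 (σ • u)‖ = ‖σ‖ := by
  rw [WithLp.toLp_smul, norm_smul, hu, mul_one]

/-- The torus components of a holomorphic function on the Hartogs triangle are multiples of the
monomials `⟨z, u⟩ ^ N * w ^ m`, and the function is the sum of these on `ℂ u × ℂ`. The rotation
around `ℂ u` projects to functions of `(⟨z, u⟩, w)`, by the mean value property. -/
theorem exists_torus_expansion (hk : 1 ≤ k) {h : (Fin n → ℂ) × ℂ → ℂ}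
    (hh : DifferentiableOn ℂ h (hartogsTriangle n k)) {u : Fin n → ℂ}
    (hu : ‖WithLp.toLp 2 u‖ = 1) :
    ∃ d : ℕ → ℤ → ℂ,
      (∀ p ∈ hartogsTriangle n k, ∀ (N : ℕ) (m : ℤ),
        ∫ g, (fourier (-m) g.1 * fourier (-(N : ℤ)) g.2.1) * h (torusRot u g p) ∂torusHaar =
          d N m * herm p.1 u ^ N * p.2 ^ m) ∧
      ∀ σ τ : ℂ, (σ • u, τ) ∈ hartogsTriangle n k → ∃ c : ℕ → ℂ,
        (∀ N, HasSum (fun m => d N m * σ ^ N * τ ^ m) (c N)) ∧ HasSum c (h (σ • u, τ)) := by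
  have hmem : ∀ σ τ : ℂ, (σ • u, τ) ∈ hartogsTriangle n k ↔ ‖σ‖ ^ k < ‖τ‖ ∧ ‖τ‖ < 1 := by
    intro σ τ
    simp only [hartogsTriangle, Set.mem_ofPred_eq, norm_toLp_smul hu]
  obtain ⟨d, hd⟩ := exists_taylor_laurent hk (H := fun σ τ => h (σ • u, τ)) (by
    refine hh.comp (f := fun q : ℂ × ℂ => (q.1 • u, q.2)) (by fun_prop) fun q hq => ?_
    exact (hmem _ _).2 hq)
  refine ⟨d, fun p hp N m => ?_, fun σ τ hστ =>
    (hd σ τ ((hmem σ τ).1 hστ).1 ((hmem σ τ).1 hστ).2).2⟩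
  have hσ : ‖herm p.1 u‖ ^ k < ‖p.2‖ := by
    refine lt_of_le_of_lt ?_ hp.1
    have := norm_herm_le p.1 u
    rw [hu, mul_one] at this
    gcongr
  have hcont : Continuous fun g : UnitAddCircle × UnitAddCircle × UnitAddCircle =>
      (fourier (-m) g.1 * fourier (-(N : ℤ)) g.2.1) * h (torusRot u g p) := by
    refine Continuous.mul (by fun_prop) (hh.continuousOn.comp_continuous ?_
      fun g => torusRot_mem hu g hp)
    exact (continuous_torusRot u).comp (f := fun g => (g, p)) (by fun_prop)
  rw [integral_prod _ (hcont.integrable_of_hasCompactSupport (HasCompactSupport.of_compactSpace _))]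
  rw [← (hd _ _ hσ hp.2).1 N m, fourierCoeff]
  congr 1
  ext θ
  have hcont' : Continuous fun g : UnitAddCircle × UnitAddCircle =>
      (fourier (-m) θ * fourier (-(N : ℤ)) g.1) * h (torusRot u (θ, g) p) :=
    hcont.comp (f := fun g => (θ, g)) (by fun_prop)
  rw [integral_prod _
      (hcont'.integrable_of_hasCompactSupport (HasCompactSupport.of_compactSpace _)),
    fourierCoeff, smul_eq_mul, ← integral_const_mul]
  congr 1
  ext φ
  refine (integral_const_mul (fourier (-m) θ * fourier (-(N : ℤ)) φ)
    (fun y => h (torusRot u (θ, φ, y) p))).trans ?_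
  rw [mul_assoc, smul_eq_mul]
  congr 2
  have hmv := integral_unitPhase_eq_center (ζ := 1) (f := fun ζ : ℂ =>
    h (unitPhase φ • (herm p.1 u • u + ζ • (p.1 - herm p.1 u • u)), unitPhase θ * p.2)) (by
      refine hh.comp (f := fun ζ : ℂ =>
        (unitPhase φ • (herm p.1 u • u + ζ • (p.1 - herm p.1 u • u)), unitPhase θ * p.2))
        (by fun_prop) fun ζ hζ => ?_
      rw [norm_one, Metric.mem_closedBall, dist_zero_right] at hζ
      refine ⟨?_, ?_⟩
      · simp only [WithLp.toLp_smul 2 (unitPhase φ), norm_smul, norm_mul, norm_unitPhase, one_mul]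
        refine lt_of_le_of_lt ?_ hp.1
        have := norm_torusAct_le hu hζ p.1
        gcongr
      · simp only [norm_mul, norm_unitPhase, one_mul]
        exact hp.2)
  simp only [mul_one, zero_smul, add_zero, smul_smul] at hmv
  simp only [torusRot, torusAct]
  simp only [smul_add, smul_smul] at hmv ⊢
  exact hmv

theorem herm_torusRot {u : Fin n → ℂ} (hu : ‖WithLp.toLp 2 u‖ = 1)
    (g : UnitAddCircle × UnitAddCircle × UnitAddCircle) (p : (Fin n → ℂ) × ℂ) :
    herm (torusRot u g p).1 u = unitPhase g.2.1 * herm p.1 u := herm_torusAct hu _ _ _ p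

theorem conj_unitPhase (θ : UnitAddCircle) : conj (unitPhase θ) = (unitPhase θ)⁻¹ := by
  rw [unitPhase, ← Circle.coe_inv_eq_conj, Circle.coe_inv]

theorem lintegral_sq_lt_top {Y : Type*} [MeasurableSpace Y] {μ : Measure Y} {f : Y → ℂ}
    (hf : MemLp f 2 μ) : ∫⁻ y, ‖f y‖ₑ ^ 2 ∂μ < ⊤ := by
  have := (eLpNorm_lt_top_iff_lintegral_rpow_enorm_lt_top (p := 2) two_ne_zero (by simp)).1 hf.2
  simpa using this

theorem sq_lintegral_enorm_le {Y : Type*} [MeasurableSpace Y] {ν : Measure Y}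
    [IsProbabilityMeasure ν] {f : Y → ℂ} (hf : AEStronglyMeasurable f ν) :
    (∫⁻ y, ‖f y‖ₑ ∂ν) ^ 2 ≤ ∫⁻ y, ‖f y‖ₑ ^ 2 ∂ν := by
  have h := eLpNorm_le_eLpNorm_of_exponent_le (p := 1) (q := 2) (by norm_num) hf
  rw [eLpNorm_one_eq_lintegral_enorm] at h
  have h2 := eLpNorm_nnreal_pow_eq_lintegral (f := f) (μ := ν) (p := 2) two_ne_zero
  simp only [NNReal.coe_ofNat, ENNReal.rpow_ofNat, ENNReal.coe_ofNat] at h2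
  rw [← h2]
  gcongr

theorem enorm_monomial_sq (c a b : ℂ) (N : ℕ) (m : ℤ) :
    ‖c * a ^ N * b ^ m‖ₑ ^ 2 =
      ‖c‖ₑ ^ 2 * (ENNReal.ofReal (‖a‖ ^ (2 * N)) * ENNReal.ofReal (‖b‖ ^ (2 * m))) := by
  rw [← ofReal_norm, ← ofReal_norm, ← ENNReal.ofReal_pow (norm_nonneg _),
    ← ENNReal.ofReal_pow (norm_nonneg _), ← ENNReal.ofReal_mul (by positivity),
    ← ENNReal.ofReal_mul (by positivity)]
  congr 1
  rw [norm_mul, norm_mul, norm_pow, norm_zpow, mul_pow, mul_pow, ← pow_mul, mul_comm N,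
    ← zpow_natCast (‖b‖ ^ m), ← zpow_mul, mul_comm m, mul_assoc]
  norm_num

/-- Square integrability excludes the monomials of infinite norm. -/
theorem torus_coeff_eq_zero (hn : 1 ≤ n) (hk : 1 ≤ k) {h : (Fin n → ℂ) × ℂ → ℂ}
    (hh : IsInBergmanSpace (hartogsTriangle n k) h) {u : Fin n → ℂ}
    (hu : ‖WithLp.toLp 2 u‖ = 1) {N : ℕ} {m : ℤ} {d : ℂ}
    (hd : ∀ p ∈ hartogsTriangle n k,
      ∫ g, (fourier (-m) g.1 * fourier (-(N : ℤ)) g.2.1) * h (torusRot u g p) ∂torusHaar =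
        d * herm p.1 u ^ N * p.2 ^ m) (hw : kernelWeight n k N m = 0) : d = 0 := by
  have hpt : ∀ p ∈ hartogsTriangle n k, ‖d * herm p.1 u ^ N * p.2 ^ m‖ₑ ^ 2 ≤
      ∫⁻ g, ‖h (torusRot u g p)‖ₑ ^ 2 ∂torusHaar := by
    intro p hp
    rw [← hd p hp]
    have hcont : Continuous fun g : UnitAddCircle × UnitAddCircle × UnitAddCircle =>
        h (torusRot u g p) :=
      hh.1.continuousOn.comp_continuous
        ((continuous_torusRot u).comp (f := fun g => (g, p)) (by fun_prop))
        fun g => torusRot_mem hu g hp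
    refine le_trans ?_ (sq_lintegral_enorm_le (ν := torusHaar) hcont.aestronglyMeasurable)
    gcongr
    refine (enorm_integral_le_lintegral_enorm _).trans_eq ?_
    congr 1
    ext g
    rw [enorm_mul, enorm_mul, ← ofReal_norm (fourier (-m) g.1),
      ← ofReal_norm (fourier (-(N : ℤ)) g.2.1), fourier_eq_unitPhase_zpow,
      fourier_eq_unitPhase_zpow,
      norm_zpow, norm_zpow, norm_unitPhase, norm_unitPhase]
    simp
  have h1 : ∫⁻ p in hartogsTriangle n k, ‖d * herm p.1 u ^ N * p.2 ^ m‖ₑ ^ 2 < ⊤ := by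
    refine lt_of_le_of_lt (setLIntegral_mono' measurableSet_hartogsTriangle hpt) ?_
    rw [← lintegral_eq_lintegral_average (ν := torusHaar) (ρ := torusRot u)
      (F := fun p => ‖h p‖ₑ ^ 2) (continuous_torusRot u).measurable
      (measurePreserving_torusRot hu) (hh.2.1.enorm.pow_const 2)]
    exact lintegral_sq_lt_top hh.2
  simp_rw [enorm_monomial_sq] at h1
  have hm : Measurable fun p : (Fin n → ℂ) × ℂ =>
      ENNReal.ofReal (‖herm p.1 u‖ ^ (2 * N)) * ENNReal.ofReal (‖p.2‖ ^ (2 * m)) := by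
    have := (continuous_herm_left u).measurable.comp
      (measurable_fst : Measurable (Prod.fst : (Fin n → ℂ) × ℂ → _))
    fun_prop
  rw [lintegral_const_mul _ hm, lintegral_monomial hn hk hu, hw] at h1
  by_contra hd0
  simp [ENNReal.mul_top, hd0] at h1

theorem aestronglyMeasurable_monomial (u : Fin n → ℂ) (N : ℕ) (m : ℤ)
    (μ : Measure ((Fin n → ℂ) × ℂ)) :
    AEStronglyMeasurable (fun p : (Fin n → ℂ) × ℂ => herm p.1 u ^ N * p.2 ^ m) μ := by
  have h1 := (continuous_herm_left u).measurable.comp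
    (measurable_fst : Measurable (Prod.fst : (Fin n → ℂ) × ℂ → _))
  have : Measurable fun p : (Fin n → ℂ) × ℂ => herm p.1 u ^ N * p.2 ^ m :=
    (h1.pow_const N).mul (by fun_prop)
  exact this.aestronglyMeasurable

theorem kernelWeight_nonneg (N : ℕ) (m : ℤ) : 0 ≤ kernelWeight n k N m := by
  unfold kernelWeight
  positivity

theorem memLp_monomial_and_integral_sq (hn : 1 ≤ n) (hk : 1 ≤ k) {u : Fin n → ℂ}
    (hu : ‖WithLp.toLp 2 u‖ = 1) {N : ℕ} {m : ℤ} (hw : kernelWeight n k N m ≠ 0) :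
    MemLp (fun p : (Fin n → ℂ) × ℂ => herm p.1 u ^ N * p.2 ^ m) 2
        (volume.restrict (hartogsTriangle n k)) ∧
      ∫ p in hartogsTriangle n k, ‖herm p.1 u ^ N * p.2 ^ m‖ ^ 2 =
        (kernelWeight n k N m)⁻¹ := by
  have hpos : 0 < kernelWeight n k N m := lt_of_le_of_ne (kernelWeight_nonneg N m) (Ne.symm hw)
  have hae := aestronglyMeasurable_monomial u N m (volume.restrict (hartogsTriangle n k))
  have h1 : ∫⁻ p in hartogsTriangle n k, ENNReal.ofReal (‖herm p.1 u ^ N * p.2 ^ m‖ ^ 2) =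
      ENNReal.ofReal (kernelWeight n k N m)⁻¹ := by
    rw [ENNReal.ofReal_inv_of_pos hpos, ← lintegral_monomial hn hk hu N m]
    refine lintegral_congr fun p => ?_
    have := enorm_monomial_sq 1 (herm p.1 u) p.2 N m
    rw [one_mul, enorm_one, one_pow, one_mul] at this
    rw [← this, ENNReal.ofReal_pow (norm_nonneg _), ofReal_norm]
  have hint : Integrable (fun p : (Fin n → ℂ) × ℂ => ‖herm p.1 u ^ N * p.2 ^ m‖ ^ 2)
      (volume.restrict (hartogsTriangle n k)) := by
    refine ⟨hae.norm.pow 2, ?_⟩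
    rw [hasFiniteIntegral_iff_ofReal (Filter.Eventually.of_forall fun p => by positivity), h1]
    exact ENNReal.ofReal_lt_top
  refine ⟨(memLp_two_iff_integrable_sq_norm hae).2 hint, ?_⟩
  rw [← ofReal_integral_eq_lintegral_ofReal hint
    (Filter.Eventually.of_forall fun p => by positivity),
    ENNReal.ofReal_eq_ofReal_iff (integral_nonneg fun p => by positivity)
      (inv_nonneg.2 hpos.le)] at h1
  exact h1

/-- The inner product of a function in the Bergman space with a monomial, by averaging. -/
theorem integral_mul_conj_monomial (hn : 1 ≤ n) (hk : 1 ≤ k) {h : (Fin n → ℂ) × ℂ → ℂ}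
    (hh : IsInBergmanSpace (hartogsTriangle n k) h) {u : Fin n → ℂ}
    (hu : ‖WithLp.toLp 2 u‖ = 1) {N : ℕ} {m : ℤ} {d : ℂ}
    (hd : ∀ p ∈ hartogsTriangle n k,
      ∫ g, (fourier (-m) g.1 * fourier (-(N : ℤ)) g.2.1) * h (torusRot u g p) ∂torusHaar =
        d * herm p.1 u ^ N * p.2 ^ m) (hw : kernelWeight n k N m ≠ 0) :
    ∫ p in hartogsTriangle n k, conj (herm p.1 u ^ N * p.2 ^ m) * h p =
      d * (kernelWeight n k N m : ℂ)⁻¹ := by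
  obtain ⟨hmem, hval⟩ := memLp_monomial_and_integral_sq hn hk hu hw
  have hint : Integrable (fun p : (Fin n → ℂ) × ℂ => conj (herm p.1 u ^ N * p.2 ^ m) * h p)
      (volume.restrict (hartogsTriangle n k)) := by
    have := MemLp.integrable_mul (p := 2) (q := 2) hmem.star hh.2
    exact this
  rw [integral_eq_integral_average (ν := torusHaar) (ρ := torusRot u)
    (continuous_torusRot u).measurable (measurePreserving_torusRot hu) hint]
  have : ∀ p ∈ hartogsTriangle n k, ∫ g, conj (herm (torusRot u g p).1 u ^ N *
      (torusRot u g p).2 ^ m) * h (torusRot u g p) ∂torusHaar =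
      d * ((‖herm p.1 u ^ N * p.2 ^ m‖ ^ 2 : ℝ) : ℂ) := by
    intro p hp
    have e : ∀ g : UnitAddCircle × UnitAddCircle × UnitAddCircle,
        conj (herm (torusRot u g p).1 u ^ N * (torusRot u g p).2 ^ m) * h (torusRot u g p) =
        conj (herm p.1 u ^ N * p.2 ^ m) *
          ((fourier (-m) g.1 * fourier (-(N : ℤ)) g.2.1) * h (torusRot u g p)) := by
      intro g
      rw [herm_torusRot hu, fourier_eq_unitPhase_zpow, fourier_eq_unitPhase_zpow]
      have e2 : (torusRot u g p).2 = unitPhase g.1 * p.2 := rfl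
      rw [e2, mul_pow, mul_zpow, map_mul, map_mul, map_mul, map_mul, map_pow, map_zpow₀,
        conj_unitPhase, conj_unitPhase, zpow_neg, zpow_neg, inv_pow, inv_zpow, zpow_natCast]
      ring
    simp_rw [e]
    rw [integral_const_mul, hd p hp, Complex.ofReal_pow, ← Complex.conj_mul']
    ring
  rw [setIntegral_congr_fun measurableSet_hartogsTriangle this, integral_const_mul,
    integral_complex_ofReal, hval, Complex.ofReal_inv]

/-! ### The reproducing property and bounds for the kernel -/

theorem norm_herm_pow_lt {p q : (Fin n → ℂ) × ℂ} (hp : p ∈ hartogsTriangle n k)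
    (hq : q ∈ hartogsTriangle n k) :
    ‖herm p.1 q.1‖ ^ k < ‖p.2 * conj q.2‖ ∧ ‖p.2 * conj q.2‖ < 1 := by
  rw [norm_mul, RCLike.norm_conj]
  have hp2 : 0 < ‖p.2‖ := norm_pos_iff.2 (snd_ne_zero_of_mem hp)
  refine ⟨?_, mul_lt_one_of_nonneg_of_lt_one_left (norm_nonneg _) hp.2 hq.2.le⟩
  calc ‖herm p.1 q.1‖ ^ k ≤ (‖WithLp.toLp 2 p.1‖ * ‖WithLp.toLp 2 q.1‖) ^ k := by
        gcongr
        exact norm_herm_le _ _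
    _ = ‖WithLp.toLp 2 p.1‖ ^ k * ‖WithLp.toLp 2 q.1‖ ^ k := mul_pow _ _ _
    _ ≤ ‖p.2‖ * ‖WithLp.toLp 2 q.1‖ ^ k := by
        gcongr
        exact hp.1.le
    _ < ‖p.2‖ * ‖q.2‖ := by
        gcongr
        exact hq.1

theorem hartogsKernel_eq (p q : (Fin n → ℂ) × ℂ) : hartogsKernel n k p q =
    (n.factorial : ℂ) * (∑ l ∈ Finset.range (n + 2),
      (kernelCoeff n k l).eval (herm p.1 q.1) * (p.2 * conj q.2) ^ l) /
    ((Real.pi : ℂ) ^ (n + 1) * (k : ℂ) * (1 - p.2 * conj q.2) ^ 2 *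
      (p.2 * conj q.2 - herm p.1 q.1 ^ k) ^ (n + 1)) := rfl

theorem hasSum_hartogsKernel (hk : 1 ≤ k) {p q : (Fin n → ℂ) × ℂ} (hp : p ∈ hartogsTriangle n k)
    (hq : q ∈ hartogsTriangle n k) :
    HasSum (fun i : ℕ × ℤ => (kernelWeight n k i.1 i.2 : ℂ) *
      (herm p.1 q.1 ^ i.1 * (p.2 * conj q.2) ^ i.2)) (hartogsKernel n k p q) := by
  rw [hartogsKernel_eq]
  exact hasSum_kernelWeight hk (norm_herm_pow_lt hp hq).1 (norm_herm_pow_lt hp hq).2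

theorem conj_hartogsKernel (hk : 1 ≤ k) {p q : (Fin n → ℂ) × ℂ} (hp : p ∈ hartogsTriangle n k)
    (hq : q ∈ hartogsTriangle n k) : conj (hartogsKernel n k p q) = hartogsKernel n k q p := by
  have h1 := (hasSum_hartogsKernel hk hp hq).map (starRingEnd ℂ) Complex.continuous_conj
  refine (h1.congr_fun fun i => ?_).unique (hasSum_hartogsKernel hk hq hp) |>.symm ▸ rfl
  simp only [Function.comp, map_mul, map_pow, map_zpow₀, Complex.conj_ofReal, conj_herm,
    Complex.conj_conj, mul_comm]

theorem kernel_denominators_ne_zero {p q : (Fin n → ℂ) × ℂ}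
    (hp : p ∈ hartogsTriangle n k) (hq : q ∈ hartogsTriangle n k) :
    1 - p.2 * conj q.2 ≠ 0 ∧ p.2 * conj q.2 - herm p.1 q.1 ^ k ≠ 0 := by
  obtain ⟨h1, h2⟩ := norm_herm_pow_lt hp hq
  constructor
  · intro h
    rw [← sub_eq_zero.1 h, norm_one] at h2
    exact lt_irrefl _ h2
  · intro h
    rw [sub_eq_zero.1 h, norm_pow] at h1
    exact lt_irrefl _ h1

theorem differentiableOn_hartogsKernel (hk : 1 ≤ k) {q : (Fin n → ℂ) × ℂ}
    (hq : q ∈ hartogsTriangle n k) :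
    DifferentiableOn ℂ (fun p => hartogsKernel n k p q) (hartogsTriangle n k) := by
  have hherm : Differentiable ℂ fun p : (Fin n → ℂ) × ℂ => herm p.1 q.1 := by
    unfold herm
    fun_prop
  have hk0 : (k : ℂ) ≠ 0 := by
    have : k ≠ 0 := by omega
    exact_mod_cast this
  have hpi : (Real.pi : ℂ) ≠ 0 := by exact_mod_cast Real.pi_ne_zero
  have hnum : Differentiable ℂ fun p : (Fin n → ℂ) × ℂ => (n.factorial : ℂ) *
      ∑ l ∈ Finset.range (n + 2),
        (kernelCoeff n k l).eval (herm p.1 q.1) * (p.2 * conj q.2) ^ l := by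
    refine Differentiable.const_mul (Differentiable.fun_sum fun l _ => ?_) _
    exact ((kernelCoeff n k l).differentiable.comp hherm).mul (by fun_prop)
  have hden : Differentiable ℂ fun p : (Fin n → ℂ) × ℂ =>
      (Real.pi : ℂ) ^ (n + 1) * (k : ℂ) * (1 - p.2 * conj q.2) ^ 2 *
        (p.2 * conj q.2 - herm p.1 q.1 ^ k) ^ (n + 1) := by
    fun_prop
  refine (hnum.differentiableOn.mul (hden.differentiableOn.inv fun p hp => ?_)).congr
    fun p _ => (hartogsKernel_eq p q).trans (div_eq_mul_inv _ _)
  obtain ⟨h1, h2⟩ := kernel_denominators_ne_zero hp hq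
  exact mul_ne_zero (mul_ne_zero (mul_ne_zero (pow_ne_zero _ hpi) hk0) (pow_ne_zero _ h1))
    (pow_ne_zero _ h2)

theorem exists_unit_vector (hn : 1 ≤ n) (z : Fin n → ℂ) :
    ∃ (u : Fin n → ℂ) (σ : ℂ), ‖WithLp.toLp 2 u‖ = 1 ∧ z = σ • u := by
  by_cases hz : z = 0
  · refine ⟨Pi.single ⟨0, hn⟩ 1, 0, ?_, by simp [hz]⟩
    rw [PiLp.toLp_single]
    simp
  · have hz' : ‖WithLp.toLp 2 z‖ ≠ 0 := by simpa using hz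
    have hzC : (‖WithLp.toLp 2 z‖ : ℂ) ≠ 0 := by exact_mod_cast hz'
    refine ⟨(‖WithLp.toLp 2 z‖ : ℂ)⁻¹ • z, ‖WithLp.toLp 2 z‖, ?_, ?_⟩
    · rw [WithLp.toLp_smul, norm_smul, norm_inv, Complex.norm_real, norm_norm, inv_mul_cancel₀ hz']
    · rw [smul_smul, mul_inv_cancel₀ hzC, one_smul]

theorem one_le_mul_kernelWeight (hk : 1 ≤ k) {N : ℕ} {m : ℤ} (hw : kernelWeight n k N m ≠ 0) :
    1 ≤ Real.pi ^ (n + 1) * k * kernelWeight n k N m := by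
  have hk0 : (0 : ℝ) < k := by exact_mod_cast hk
  have hD : 1 ≤ (k * (m + 1) + N + n : ℤ).toNat := by
    by_contra h
    apply hw
    have : (k * (m + 1) + N + n : ℤ).toNat = 0 := by omega
    simp [kernelWeight, this]
  have e : Real.pi ^ (n + 1) * k * kernelWeight n k N m =
      ((n.factorial * (N + n).choose n * (k * (m + 1) + N + n : ℤ).toNat : ℕ) : ℝ) := by
    rw [kernelWeight]
    push_cast
    field_simp
  rw [e]
  exact_mod_cast Nat.mul_pos (Nat.mul_pos (Nat.factorial_pos n) (Nat.choose_pos (by omega))) hD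

/-- The reproducing property. -/
theorem integral_hartogsKernel_mul (hn : 1 ≤ n) (hk : 1 ≤ k) {h : (Fin n → ℂ) × ℂ → ℂ}
    (hh : IsInBergmanSpace (hartogsTriangle n k) h) {x : (Fin n → ℂ) × ℂ}
    (hx : x ∈ hartogsTriangle n k) :
    ∫ y in hartogsTriangle n k, hartogsKernel n k x y * h y = h x := by
  obtain ⟨z, w⟩ := x
  obtain ⟨u, σ, hu, rfl⟩ := exists_unit_vector hn z
  obtain ⟨d, hd, hexp⟩ := exists_torus_expansion hk hh.1 hu
  obtain ⟨c, hc, hcsum⟩ := hexp σ w hx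
  have hxk : ‖σ‖ ^ k < ‖w‖ := by
    have := hx.1
    simp only [norm_toLp_smul hu] at this
    exact this
  set μ := volume.restrict (hartogsTriangle n k) with hμ
  set F : ℕ × ℤ → (Fin n → ℂ) × ℂ → ℂ := fun i y => (kernelWeight n k i.1 i.2 : ℂ) *
    (herm (σ • u) y.1 ^ i.1 * (w * conj y.2) ^ i.2) * h y with hF
  have hFeq : ∀ i y, F i y = (kernelWeight n k i.1 i.2 : ℂ) * (σ ^ i.1 * w ^ i.2) *
      (conj (herm y.1 u ^ i.1 * y.2 ^ i.2) * h y) := by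
    intro i y
    simp only [hF, herm_smul, mul_pow, mul_zpow, map_mul, map_pow, map_zpow₀, conj_herm]
    ring
  have hmul : ∀ i : ℕ × ℤ, kernelWeight n k i.1 i.2 ≠ 0 →
      Integrable (fun y => conj (herm y.1 u ^ i.1 * y.2 ^ i.2) * h y) μ := by
    intro i hi
    exact MemLp.integrable_mul (p := 2) (q := 2)
      (memLp_monomial_and_integral_sq hn hk hu hi).1.star hh.2
  have hFint : ∀ i, Integrable (F i) μ := by
    intro i
    by_cases hi : kernelWeight n k i.1 i.2 = 0
    · have : F i = fun _ => 0 := by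
        ext y
        simp [hF, hi]
      rw [this]
      exact integrable_zero _ _ _
    · have : F i = fun y => (kernelWeight n k i.1 i.2 : ℂ) * (σ ^ i.1 * w ^ i.2) *
          (conj (herm y.1 u ^ i.1 * y.2 ^ i.2) * h y) := funext (hFeq i)
      rw [this]
      exact (hmul i hi).const_mul _
  have hh2 : Integrable (fun y => ‖h y‖ ^ 2) μ := (memLp_two_iff_integrable_sq_norm hh.2.1).1 hh.2
  set S := ∫ y, ‖h y‖ ^ 2 ∂μ with hS
  -- `2 |f h| ≤ |f|² + |h|²`, and the squared norm of each monomial is bounded since its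
  -- inverse, the weight, is bounded below.
  have hFle : ∀ i, ∫ y, ‖F i y‖ ∂μ ≤ ‖(kernelWeight n k i.1 i.2 : ℂ) *
      ((‖σ‖ : ℂ) ^ i.1 * (‖w‖ : ℂ) ^ i.2)‖ * ((Real.pi ^ (n + 1) * k + S) / 2) := by
    intro i
    by_cases hi : kernelWeight n k i.1 i.2 = 0
    · simp [hF, hi]
    · obtain ⟨hmem, hval⟩ := memLp_monomial_and_integral_sq hn hk hu hi
      have hpos : 0 < kernelWeight n k i.1 i.2 :=
        lt_of_le_of_ne (kernelWeight_nonneg _ _) (Ne.symm hi)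
      have hm2 := (memLp_two_iff_integrable_sq_norm hmem.1).1 hmem
      have h1 : ∫ y, ‖conj (herm y.1 u ^ i.1 * y.2 ^ i.2) * h y‖ ∂μ ≤
          ((kernelWeight n k i.1 i.2)⁻¹ + S) / 2 := by
        rw [← hval, hS, ← integral_add hm2 hh2, ← integral_div]
        refine integral_mono (hmul i hi).norm ((hm2.add hh2).div_const 2) fun y => ?_
        simp only [norm_mul, RCLike.norm_conj]
        rw [← norm_mul]
        nlinarith [sq_nonneg (‖herm y.1 u ^ i.1 * y.2 ^ i.2‖ - ‖h y‖)]
      have h2 : (kernelWeight n k i.1 i.2)⁻¹ ≤ Real.pi ^ (n + 1) * k := by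
        rw [inv_le_iff_one_le_mul₀ hpos]
        exact one_le_mul_kernelWeight hk hi
      simp_rw [hFeq, norm_mul _ (conj _ * _), integral_const_mul]
      have h3 : ‖(kernelWeight n k i.1 i.2 : ℂ) * (σ ^ i.1 * w ^ i.2)‖ =
          ‖(kernelWeight n k i.1 i.2 : ℂ) * ((‖σ‖ : ℂ) ^ i.1 * (‖w‖ : ℂ) ^ i.2)‖ := by
        simp [norm_zpow]
      rw [h3]
      gcongr
      exact h1.trans (by linarith)
  have hsummable : Summable fun i => ∫ y, ‖F i y‖ ∂μ := by
    refine Summable.of_nonneg_of_le (fun i => integral_nonneg fun y => norm_nonneg _) hFle ?_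
    refine Summable.mul_right _ ?_
    exact (hasSum_kernelWeight (n := n) (a := (‖w‖ : ℂ)) (b := (‖σ‖ : ℂ)) hk (by simpa using hxk)
      (by simpa using hx.2)).summable.norm
  have hmain := hasSum_integral_of_summable_integral_norm hFint hsummable
  have hlhs : ∫ y, ∑' i, F i y ∂μ = ∫ y, hartogsKernel n k (σ • u, w) y * h y ∂μ := by
    refine setIntegral_congr_fun measurableSet_hartogsTriangle fun y hy => ?_
    exact ((hasSum_hartogsKernel hk hx hy).mul_right (h y)).tsum_eq
  have hterm : ∀ i, ∫ y, F i y ∂μ = d i.1 i.2 * σ ^ i.1 * w ^ i.2 := by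
    intro i
    by_cases hi : kernelWeight n k i.1 i.2 = 0
    · rw [torus_coeff_eq_zero hn hk hh hu (fun p hp => hd p hp i.1 i.2) hi]
      simp [hF, hi]
    · have hiC : (kernelWeight n k i.1 i.2 : ℂ) ≠ 0 := by exact_mod_cast hi
      simp_rw [hFeq]
      rw [integral_const_mul, integral_mul_conj_monomial hn hk hh hu
        (fun p hp => hd p hp i.1 i.2) hi]
      field_simp
  simp_rw [hterm] at hmain
  rw [hlhs] at hmain
  exact (hmain.prod_fiberwise hc).unique hcsum

/-- Positive real monomials in `|z|` and `|w|` are square integrable under the same condition as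
the holomorphic ones. -/
theorem memLp_norm_monomial (hk : 1 ≤ k) (J : ℕ) (m : ℤ) (hD : 0 < (k * (m + 1) + J + n : ℤ)) :
    MemLp (fun y : (Fin n → ℂ) × ℂ => ‖WithLp.toLp 2 y.1‖ ^ J * ‖y.2‖ ^ m) 2
      (volume.restrict (hartogsTriangle n k)) := by
  have hc := continuous_toLp_norm (n := n)
  have hc1 : Measurable fun y : (Fin n → ℂ) × ℂ => ‖WithLp.toLp 2 y.1‖ :=
    (hc.comp continuous_fst).measurable
  have hae : AEStronglyMeasurable
      (fun y : (Fin n → ℂ) × ℂ => ‖WithLp.toLp 2 y.1‖ ^ J * ‖y.2‖ ^ m)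
      (volume.restrict (hartogsTriangle n k)) := by
    have : Measurable fun y : (Fin n → ℂ) × ℂ => ‖WithLp.toLp 2 y.1‖ ^ J * ‖y.2‖ ^ m :=
      (hc1.pow_const J).mul (by fun_prop)
    exact this.aestronglyMeasurable
  rw [memLp_two_iff_integrable_sq hae]
  refine ⟨hae.pow 2, ?_⟩
  rw [hasFiniteIntegral_iff_ofReal (Filter.Eventually.of_forall fun y => by positivity)]
  have hΦ : Measurable fun s : Fin n → ℂ => ENNReal.ofReal (‖WithLp.toLp 2 s‖ ^ (2 * J)) := by
    fun_prop
  have h := lintegral_hartogs_homogeneous (n := n) hk hΦ (J := J) (fun r hr s => by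
    rw [← ENNReal.ofReal_mul (by positivity), WithLp.toLp_smul, norm_smul, Real.norm_eq_abs,
      abs_of_pos hr, mul_pow]) m
  rw [if_pos hD] at h
  have e : ∀ y : (Fin n → ℂ) × ℂ, ENNReal.ofReal ((‖WithLp.toLp 2 y.1‖ ^ J * ‖y.2‖ ^ m) ^ 2) =
      ENNReal.ofReal (‖WithLp.toLp 2 y.1‖ ^ (2 * J)) * ENNReal.ofReal (‖y.2‖ ^ (2 * m)) := by
    intro y
    rw [← ENNReal.ofReal_mul (by positivity), mul_pow, ← pow_mul, mul_comm J,
      ← zpow_natCast (‖y.2‖ ^ m), ← zpow_mul, mul_comm m]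
    rfl
  simp_rw [e]
  rw [h]
  refine ENNReal.mul_lt_top ?_ ENNReal.ofReal_lt_top
  have hset : MeasurableSet {s : Fin n → ℂ | ‖WithLp.toLp 2 s‖ < 1} :=
    (isOpen_lt hc continuous_const).measurableSet
  calc ∫⁻ s in {s : Fin n → ℂ | ‖WithLp.toLp 2 s‖ < 1},
        ENNReal.ofReal (‖WithLp.toLp 2 s‖ ^ (2 * J))
      ≤ ∫⁻ _ in {s : Fin n → ℂ | ‖WithLp.toLp 2 s‖ < 1}, 1 := by
        refine setLIntegral_mono' hset fun s hs => ?_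
        rw [ENNReal.ofReal_le_one]
        exact pow_le_one₀ (norm_nonneg _) (le_of_lt hs)
    _ = volume {s : Fin n → ℂ | ‖WithLp.toLp 2 s‖ < 1} := setLIntegral_one _
    _ ≤ volume (Metric.ball (0 : Fin n → ℂ) 1) := by
        refine measure_mono fun s hs => ?_
        rw [mem_ball_zero_iff, pi_norm_lt_iff one_pos]
        exact fun i => (PiLp.norm_apply_le (WithLp.toLp 2 s) i).trans_lt hs
    _ < ⊤ := measure_ball_lt_top

/-- A square integrable bound for the kernel, locally uniform in its first argument. The
denominator is bounded below by a multiple of `|t| ^ (n + 1)`; the terms of the numerator divided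
by it are square integrable. -/
theorem exists_kernel_bound (hk : 1 ≤ k) {x₀ : (Fin n → ℂ) × ℂ} (hx₀ : x₀ ∈ hartogsTriangle n k) :
    ∃ V ∈ nhds x₀, V ⊆ hartogsTriangle n k ∧ ∃ G : (Fin n → ℂ) × ℂ → ℝ,
      MemLp G 2 (volume.restrict (hartogsTriangle n k)) ∧
      ∀ x ∈ V, ∀ y ∈ hartogsTriangle n k, ‖hartogsKernel n k x y‖ ≤ G y := by
  have hk0 : (0 : ℝ) < k := by exact_mod_cast hk
  have hc1 : Continuous fun p : (Fin n → ℂ) × ℂ => ‖WithLp.toLp 2 p.1‖ :=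
    continuous_toLp_norm.comp continuous_fst
  obtain ⟨δ, hδ0, hδ⟩ : ∃ δ : ℝ, 0 < δ ∧
      δ < min (1 - ‖x₀.2‖) (‖x₀.2‖ - ‖WithLp.toLp 2 x₀.1‖ ^ k) :=
    exists_between (lt_min (sub_pos.2 hx₀.2) (sub_pos.2 hx₀.1))
  have hδ1 := hδ.trans_le (min_le_left _ _)
  have hδ2 := hδ.trans_le (min_le_right _ _)
  have hopen : IsOpen {x : (Fin n → ℂ) × ℂ | δ < 1 - ‖x.2‖ ∧
      δ < ‖x.2‖ - ‖WithLp.toLp 2 x.1‖ ^ k} :=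
    (isOpen_lt continuous_const (continuous_const.sub continuous_snd.norm)).inter
      (isOpen_lt continuous_const (continuous_snd.norm.sub (hc1.pow k)))
  refine ⟨_, hopen.mem_nhds ⟨hδ1, hδ2⟩, fun x hx => ⟨by linarith [hx.2], by linarith [hx.1]⟩, ?_⟩
  refine ⟨fun y => n.factorial / (Real.pi ^ (n + 1) * k * δ ^ 2 * δ ^ (n + 1)) *
    ∑ l ∈ Finset.range (n + 2), ∑ j : Fin (n + 3) → Fin k
      with (∑ i, (j i : ℕ)) + (n + 1) + l * k = (n + 2) * k,
        ‖WithLp.toLp 2 y.1‖ ^ (∑ i : Fin (n + 1), (j i.succ.succ : ℕ)) *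
          ‖y.2‖ ^ ((l : ℤ) - (n + 1)), ?_, ?_⟩
  · refine MemLp.const_mul ?_ _
    refine memLp_finsetSum _ fun l _ => memLp_finsetSum _ fun j hj => ?_
    refine memLp_norm_monomial hk _ _ ?_
    have hj' := (Finset.mem_filter.1 hj).2
    rw [Fin.sum_univ_succ, Fin.sum_univ_succ] at hj'
    have h0 := (j 0).2
    have h1 := (j (Fin.succ 0)).2
    generalize (∑ i : Fin (n + 1), (j i.succ.succ : ℕ)) = J at hj'
    zify at hj' h0 h1
    -- The first two indices are at most `k - 1`, so `J` is at least
    -- `(n - l) * k - n + 1`, exactly what square integrability requires.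
    nlinarith
  · intro x hx y hy
    have hxΩ : x ∈ hartogsTriangle n k := ⟨by linarith [hx.2], by linarith [hx.1]⟩
    have hy2 : 0 < ‖y.2‖ := norm_pos_iff.2 (snd_ne_zero_of_mem hy)
    set a := x.2 * conj y.2 with ha
    set b := herm x.1 y.1 with hb
    have hna : ‖a‖ = ‖x.2‖ * ‖y.2‖ := by rw [ha, norm_mul, RCLike.norm_conj]
    have hx1 : ‖WithLp.toLp 2 x.1‖ ≤ 1 := (norm_fst_lt_one_of_mem hxΩ).le
    have hnb : ‖b‖ ≤ ‖WithLp.toLp 2 y.1‖ := by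
      refine (norm_herm_le _ _).trans ?_
      exact mul_le_of_le_one_left (norm_nonneg _) hx1
    have hna' : ‖a‖ ≤ ‖y.2‖ := by
      rw [hna]
      exact mul_le_of_le_one_left hy2.le hxΩ.2.le
    have hnbk : ‖b‖ ^ k ≤ ‖WithLp.toLp 2 x.1‖ ^ k * ‖y.2‖ := by
      calc ‖b‖ ^ k ≤ (‖WithLp.toLp 2 x.1‖ * ‖WithLp.toLp 2 y.1‖) ^ k := by
            gcongr
            exact norm_herm_le _ _
        _ = ‖WithLp.toLp 2 x.1‖ ^ k * ‖WithLp.toLp 2 y.1‖ ^ k := mul_pow _ _ _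
        _ ≤ _ := by
            gcongr
            exact hy.1.le
    have hden1 : δ ≤ ‖1 - a‖ := by
      have h1 := norm_sub_norm_le (1 : ℂ) a
      rw [norm_one] at h1
      have h2 : ‖a‖ ≤ ‖x.2‖ := by
        rw [hna]
        exact mul_le_of_le_one_right (norm_nonneg _) hy.2.le
      linarith [hx.1]
    have hden2 : δ * ‖y.2‖ ≤ ‖a - b ^ k‖ := by
      have h1 := norm_sub_norm_le a (b ^ k)
      rw [norm_pow, hna] at h1
      have h2 : δ * ‖y.2‖ ≤ (‖x.2‖ - ‖WithLp.toLp 2 x.1‖ ^ k) * ‖y.2‖ := by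
        gcongr
        exact hx.2.le
      linarith
    have hnum : ‖∑ l ∈ Finset.range (n + 2), (kernelCoeff n k l).eval b * a ^ l‖ ≤
        ∑ l ∈ Finset.range (n + 2), ∑ j : Fin (n + 3) → Fin k
          with (∑ i, (j i : ℕ)) + (n + 1) + l * k = (n + 2) * k,
            ‖WithLp.toLp 2 y.1‖ ^ (∑ i : Fin (n + 1), (j i.succ.succ : ℕ)) * ‖y.2‖ ^ l := by
      refine norm_sum_le_of_le _ fun l _ => ?_
      rw [kernelCoeff, eval_finsetSum, Finset.sum_mul]
      refine norm_sum_le_of_le _ fun j _ => ?_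
      rw [eval_pow, eval_X, norm_mul, norm_pow, norm_pow]
      gcongr
    have hsplit : ∀ l : ℕ, ‖y.2‖ ^ ((l : ℤ) - (n + 1)) = ‖y.2‖ ^ l / ‖y.2‖ ^ (n + 1) := by
      intro l
      rw [zpow_sub₀ hy2.ne', zpow_natCast]
      congr 1
    rw [hartogsKernel_eq, ← ha, ← hb, norm_div, norm_mul, norm_mul, norm_mul, norm_mul, norm_pow,
      norm_pow, norm_pow, Complex.norm_natCast, Complex.norm_natCast, Complex.norm_real,
      Real.norm_eq_abs, abs_of_pos Real.pi_pos]
    simp_rw [hsplit, mul_div_assoc', ← Finset.sum_div]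
    rw [mul_div_assoc', div_mul_eq_mul_div, div_div]
    have e : Real.pi ^ (n + 1) * k * δ ^ 2 * δ ^ (n + 1) * ‖y.2‖ ^ (n + 1) =
        Real.pi ^ (n + 1) * k * δ ^ 2 * (δ * ‖y.2‖) ^ (n + 1) := by
      rw [mul_pow]; ring
    rw [e]
    have hsum0 : 0 ≤ ∑ l ∈ Finset.range (n + 2), ∑ j : Fin (n + 3) → Fin k
          with (∑ i, (j i : ℕ)) + (n + 1) + l * k = (n + 2) * k,
            ‖WithLp.toLp 2 y.1‖ ^ (∑ i : Fin (n + 1), (j i.succ.succ : ℕ)) * ‖y.2‖ ^ l := by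
      positivity
    gcongr

/-! ### The Bergman projection -/

section Abstract

variable {E : Type*} [NormedAddCommGroup E] [NormedSpace ℂ E] [MeasureSpace E] {Ω : Set E}

/-- The Bergman space as a subspace of `L²(Ω)`: the classes that have a holomorphic
representative. -/
noncomputable def bergmanSubmodule (Ω : Set E) :
    Submodule ℂ (Lp ℂ 2 (volume.restrict Ω : Measure E)) where
  carrier := {F | ∃ h : E → ℂ, DifferentiableOn ℂ h Ω ∧ F =ᵐ[volume.restrict Ω] h}
  add_mem' := by
    rintro F G ⟨f, hf, hFf⟩ ⟨g, hg, hGg⟩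
    exact ⟨f + g, hf.add hg, (Lp.coeFn_add F G).trans (hFf.add hGg)⟩
  zero_mem' := ⟨0, differentiableOn_const 0, Lp.coeFn_zero _ _ _⟩
  smul_mem' := by
    rintro c F ⟨f, hf, hFf⟩
    exact ⟨c • f, hf.const_smul c, (Lp.coeFn_smul c F).trans (hFf.const_smul c)⟩

theorem inner_toLp {Y : Type*} [MeasurableSpace Y] {μ : Measure Y} {f : Y → ℂ}
    (hf : MemLp f 2 μ) (G : Lp ℂ 2 μ) {g : Y → ℂ} (hg : G =ᵐ[μ] g) :
    inner ℂ (hf.toLp f) G = ∫ y, g y * conj (f y) ∂μ := by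
  rw [L2.inner_def]
  refine integral_congr_ae ?_
  filter_upwards [hf.coeFn_toLp, hg] with y h1 h2
  rw [RCLike.inner_apply, h1, h2]

theorem memLp_of_conj {Y : Type*} [MeasurableSpace Y] {μ : Measure Y} {f : Y → ℂ}
    (hf : MemLp (fun y => conj (f y)) 2 μ) : MemLp f 2 μ :=
  hf.star.ae_eq (Filter.Eventually.of_forall fun _ => Complex.conj_conj _)

theorem isInBergmanSpace_of_ae_eq {F : Lp ℂ 2 (volume.restrict Ω : Measure E)} {h : E → ℂ}
    (hd : DifferentiableOn ℂ h Ω) (hF : F =ᵐ[volume.restrict Ω] h) : IsInBergmanSpace Ω h :=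
  ⟨hd, (Lp.memLp F).ae_eq hF⟩

/-- A reproducing kernel of the Bergman space whose integral operator maps `L²(Ω)` to holomorphic
functions is the Bergman kernel. The operator gives pointwise convergence to a holomorphic limit
for sequences of the Bergman space converging in `L²(Ω)`, hence that space is closed; and by the
reproducing property the operator is the orthogonal projection. -/
theorem isBergmanKernel_of_reproducing (hΩ : MeasurableSet Ω) {K : E → E → ℂ}
    (hmem : ∀ x ∈ Ω, IsInBergmanSpace Ω fun y => conj (K x y))
    (hrep : ∀ h : E → ℂ, IsInBergmanSpace Ω h → ∀ x ∈ Ω, ∫ y in Ω, K x y * h y = h x)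
    (hhol : ∀ f : E → ℂ, MemLp f 2 (volume.restrict Ω) →
      DifferentiableOn ℂ (fun x => ∫ y in Ω, K x y * f y) Ω) :
    IsBergmanKernel Ω K := by
  refine ⟨hmem, fun f hf => ?_⟩
  have hinner : ∀ x (hx : x ∈ Ω) (G : Lp ℂ 2 (volume.restrict Ω : Measure E)) (g : E → ℂ),
      G =ᵐ[volume.restrict Ω] g →
      inner ℂ ((hmem x hx).2.toLp _) G = ∫ y in Ω, K x y * g y := by
    intro x hx G g hg
    rw [inner_toLp (hmem x hx).2 G hg]
    simp_rw [Complex.conj_conj, mul_comm]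
  have hclosed : IsClosed (bergmanSubmodule Ω : Set (Lp ℂ 2 (volume.restrict Ω : Measure E))) := by
    refine IsSeqClosed.isClosed fun F G hF hFG => ?_
    choose h hd hae using hF
    refine ⟨_, hhol G (Lp.memLp G), ?_⟩
    have hpt : ∀ x ∈ Ω, Filter.Tendsto (fun j => h j x) Filter.atTop
        (nhds (∫ y in Ω, K x y * G y)) := by
      intro x hx
      have h1 : Filter.Tendsto (fun j => inner ℂ ((hmem x hx).2.toLp _) (F j)) Filter.atTop
          (nhds (inner ℂ ((hmem x hx).2.toLp _) G)) := tendsto_const_nhds.inner hFG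
      rw [hinner x hx G G (Filter.EventuallyEq.refl _ _)] at h1
      refine h1.congr fun j => ?_
      rw [hinner x hx (F j) (h j) (hae j), hrep _ (isInBergmanSpace_of_ae_eq (hd j) (hae j)) x hx]
    obtain ⟨ns, hns, hsub⟩ := (tendstoInMeasure_of_tendsto_Lp hFG).exists_seq_tendsto_ae
    filter_upwards [hsub, ae_all_iff.2 hae, ae_restrict_mem hΩ] with x hx1 hx2 hx3
    refine tendsto_nhds_unique hx1 ?_
    simp_rw [hx2]
    exact (hpt x hx3).comp hns.tendsto_atTop
  have : CompleteSpace (bergmanSubmodule Ω) := hclosed.completeSpace_coe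
  set P := (bergmanSubmodule Ω).starProjection (hf.toLp f) with hP
  have horth := (Submodule.mem_orthogonal _ _).1
    (Submodule.sub_starProjection_mem_orthogonal (K := bergmanSubmodule Ω) (hf.toLp f))
  obtain ⟨h, hd, hae⟩ := Submodule.starProjection_apply_mem (bergmanSubmodule Ω) (hf.toLp f)
  have hh : IsInBergmanSpace Ω h := isInBergmanSpace_of_ae_eq hd hae
  have heq : ∀ x ∈ Ω, ∫ y in Ω, K x y * f y = h x := by
    intro x hx
    have hk : (hmem x hx).2.toLp _ ∈ bergmanSubmodule Ω :=
      ⟨_, (hmem x hx).1, (hmem x hx).2.coeFn_toLp⟩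
    have h1 := horth _ hk
    rw [inner_sub_right, sub_eq_zero, hinner x hx _ f hf.coeFn_toLp, hinner x hx _ h hae,
      hrep h hh x hx] at h1
    exact h1
  have hae' : h =ᵐ[volume.restrict Ω] fun x => ∫ y in Ω, K x y * f y :=
    (ae_restrict_iff' hΩ).2 (Filter.Eventually.of_forall fun x hx => (heq x hx).symm)
  refine ⟨⟨hhol f hf, hh.2.ae_eq hae'⟩, fun g hg => ?_⟩
  have hgm : hg.2.toLp g ∈ bergmanSubmodule Ω := ⟨g, hg.1, hg.2.coeFn_toLp⟩
  have h1 := horth _ hgm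
  rw [inner_toLp hg.2 _ ((Lp.coeFn_sub _ _).trans (hf.coeFn_toLp.sub (hae.trans hae')))] at h1
  exact h1

/-- The Bergman kernel is unique. -/
theorem IsBergmanKernel.eq_on [OpensMeasurableSpace E] [(volume : Measure E).IsOpenPosMeasure]
    (hΩ : IsOpen Ω) {B K : E → E → ℂ} (hB : IsBergmanKernel Ω B) (hK : IsBergmanKernel Ω K)
    {x y : E} (hx : x ∈ Ω) (hy : y ∈ Ω) : B x y = K x y := by
  have hdense : ∀ {f g : E → ℂ}, f =ᵐ[volume.restrict Ω] g → ContinuousOn f Ω →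
      ContinuousOn g Ω → Set.EqOn f g Ω := fun h hf hg => Measure.eqOn_open_of_ae_eq h hΩ hf hg
  -- The projections of `f` agree almost everywhere, hence everywhere.
  have hproj : ∀ f : E → ℂ, MemLp f 2 (volume.restrict Ω) → ∀ x ∈ Ω,
      ∫ y in Ω, B x y * f y = ∫ y in Ω, K x y * f y := by
    intro f hf
    obtain ⟨⟨hd1, hm1⟩, ho1⟩ := hB.projection f hf
    obtain ⟨⟨hd2, hm2⟩, ho2⟩ := hK.projection f hf
    set g₁ := fun x => ∫ y in Ω, B x y * f y with hg₁
    set g₂ := fun x => ∫ y in Ω, K x y * f y with hg₂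
    have hd : IsInBergmanSpace Ω (fun x => g₁ x - g₂ x) := ⟨hd1.sub hd2, hm1.sub hm2⟩
    have i1 : Integrable (fun x => (f x - g₁ x) * conj (g₁ x - g₂ x)) (volume.restrict Ω) :=
      MemLp.integrable_mul (p := 2) (q := 2) (hf.sub hm1) hd.2.star
    have i2 : Integrable (fun x => (f x - g₂ x) * conj (g₁ x - g₂ x)) (volume.restrict Ω) :=
      MemLp.integrable_mul (p := 2) (q := 2) (hf.sub hm2) hd.2.star
    have h0 : ∫ x in Ω, ‖g₁ x - g₂ x‖ ^ 2 = 0 := by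
      have h1 := integral_sub i2 i1
      rw [ho1 _ hd, ho2 _ hd, sub_zero] at h1
      have h2 : ∀ x, (f x - g₂ x) * conj (g₁ x - g₂ x) - (f x - g₁ x) * conj (g₁ x - g₂ x) =
          ((‖g₁ x - g₂ x‖ ^ 2 : ℝ) : ℂ) := by
        intro x
        rw [Complex.ofReal_pow, ← Complex.mul_conj']
        ring
      simp_rw [h2] at h1
      rw [integral_complex_ofReal] at h1
      exact_mod_cast h1
    have hae := (integral_eq_zero_iff_of_nonneg (fun x => by positivity)
      ((memLp_two_iff_integrable_sq_norm hd.2.1).1 hd.2)).1 h0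
    refine hdense ?_ hd1.continuousOn hd2.continuousOn
    filter_upwards [hae] with x hx
    simpa [sub_eq_zero] using hx
  have hBx := hB.conj_mem x hx
  have hKx := hK.conj_mem x hx
  have hm : MemLp (fun y => conj (B x y) - conj (K x y)) 2 (volume.restrict Ω) := hBx.2.sub hKx.2
  have h1 := hproj _ hm x hx
  have hBm : MemLp (fun y => B x y) 2 (volume.restrict Ω) := memLp_of_conj hBx.2
  have hKm : MemLp (fun y => K x y) 2 (volume.restrict Ω) := memLp_of_conj hKx.2
  have i1 : Integrable (fun y => B x y * (conj (B x y) - conj (K x y))) (volume.restrict Ω) :=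
    MemLp.integrable_mul (p := 2) (q := 2) hBm hm
  have i2 : Integrable (fun y => K x y * (conj (B x y) - conj (K x y))) (volume.restrict Ω) :=
    MemLp.integrable_mul (p := 2) (q := 2) hKm hm
  have h0 : ∫ y in Ω, ‖conj (B x y) - conj (K x y)‖ ^ 2 = 0 := by
    have h2 := integral_sub i1 i2
    rw [h1, sub_self] at h2
    have h3 : ∀ y, B x y * (conj (B x y) - conj (K x y)) -
        K x y * (conj (B x y) - conj (K x y)) =
        ((‖conj (B x y) - conj (K x y)‖ ^ 2 : ℝ) : ℂ) := by
      intro y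
      rw [Complex.ofReal_pow, ← Complex.conj_mul', map_sub, Complex.conj_conj, Complex.conj_conj]
      ring
    simp_rw [h3] at h2
    rw [integral_complex_ofReal] at h2
    exact_mod_cast h2
  have hae := (integral_eq_zero_iff_of_nonneg (fun x => by positivity)
    ((memLp_two_iff_integrable_sq_norm hm.1).1 hm)).1 h0
  have := hdense (f := fun y => conj (B x y)) (g := fun y => conj (K x y)) (by
    filter_upwards [hae] with y hy
    simpa [sub_eq_zero] using hy) hBx.1.continuousOn hKx.1.continuousOn hy
  exact (starRingEnd ℂ).injective this

end Abstract

theorem conj_hartogsKernel_mem (hk : 1 ≤ k) {x : (Fin n → ℂ) × ℂ} (hx : x ∈ hartogsTriangle n k) :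
    IsInBergmanSpace (hartogsTriangle n k) fun y => conj (hartogsKernel n k x y) := by
  have hd : DifferentiableOn ℂ (fun y => conj (hartogsKernel n k x y)) (hartogsTriangle n k) :=
    (differentiableOn_hartogsKernel hk hx).congr fun y hy => conj_hartogsKernel hk hx hy
  obtain ⟨V, hV, -, G, hG, hle⟩ := exists_kernel_bound hk hx
  refine ⟨hd, hG.mono' (hd.continuousOn.aestronglyMeasurable measurableSet_hartogsTriangle) ?_⟩
  refine (ae_restrict_iff' measurableSet_hartogsTriangle).2 (Filter.Eventually.of_forall
    fun y hy => ?_)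
  rw [RCLike.norm_conj]
  exact hle x (mem_of_mem_nhds hV) y hy

theorem differentiableOn_integral_hartogsKernel (hk : 1 ≤ k) {f : (Fin n → ℂ) × ℂ → ℂ}
    (hf : MemLp f 2 (volume.restrict (hartogsTriangle n k))) :
    DifferentiableOn ℂ (fun x => ∫ y in hartogsTriangle n k, hartogsKernel n k x y * f y)
      (hartogsTriangle n k) := by
  refine differentiableOn_integral_of_dominated isOpen_hartogsTriangle ?_ ?_ ?_
  · exact (ae_restrict_iff' measurableSet_hartogsTriangle).2 (Filter.Eventually.of_forall
      fun y hy => (differentiableOn_hartogsKernel hk hy).mul_const _)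
  · intro x hx
    exact (memLp_of_conj (conj_hartogsKernel_mem hk hx).2).1.mul hf.1
  · intro x₀ hx₀
    obtain ⟨V, hV, -, G, hG, hle⟩ := exists_kernel_bound hk hx₀
    refine ⟨V, hV, fun y => G y * ‖f y‖, MemLp.integrable_mul (p := 2) (q := 2) hG hf.norm, ?_⟩
    refine (ae_restrict_iff' measurableSet_hartogsTriangle).2 (Filter.Eventually.of_forall
      fun y hy x hx => ?_)
    rw [norm_mul]
    exact mul_le_mul_of_nonneg_right (hle x hx y hy) (norm_nonneg _)

theorem isBergmanKernel_hartogsKernel (hn : 1 ≤ n) (hk : 1 ≤ k) :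
    IsBergmanKernel (hartogsTriangle n k) (hartogsKernel n k) :=
  isBergmanKernel_of_reproducing measurableSet_hartogsTriangle
    (fun _ hx => conj_hartogsKernel_mem hk hx)
    (fun _ hh _ hx => integral_hartogsKernel_mul hn hk hh hx)
    (fun _ hf => differentiableOn_integral_hartogsKernel hk hf)

theorem IsBergmanKernel.congr {E : Type*} [NormedAddCommGroup E] [NormedSpace ℂ E] [MeasureSpace E]
    {Ω : Set E} (hΩ : MeasurableSet Ω) {B K : E → E → ℂ} (hK : IsBergmanKernel Ω K)
    (h : ∀ x ∈ Ω, ∀ y ∈ Ω, B x y = K x y) : IsBergmanKernel Ω B := by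
  have hint : ∀ (f : E → ℂ), ∀ x ∈ Ω, ∫ y in Ω, B x y * f y = ∫ y in Ω, K x y * f y :=
    fun f x hx => setIntegral_congr_fun hΩ fun y hy => by simp only [h x hx y hy]
  constructor
  · intro x hx
    obtain ⟨h1, h2⟩ := hK.conj_mem x hx
    refine ⟨h1.congr fun y hy => by rw [h x hx y hy], h2.ae_eq ?_⟩
    exact (ae_restrict_iff' hΩ).2 (Filter.Eventually.of_forall fun y hy => by
      simp only [h x hx y hy])
  · intro f hf
    obtain ⟨⟨h1, h2⟩, h3⟩ := hK.projection f hf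
    refine ⟨⟨h1.congr fun x hx => hint f x hx, h2.ae_eq ?_⟩, fun g hg => ?_⟩
    · exact (ae_restrict_iff' hΩ).2 (Filter.Eventually.of_forall fun x hx => (hint f x hx).symm)
    · rw [← h3 g hg]
      exact setIntegral_congr_fun hΩ fun x hx => by simp only [hint f x hx]

end Hartogs

theorem theorem1 (n k : ℕ) (hn : 1 ≤ n) (hk : 1 ≤ k)
    (B : (Fin n → ℂ) × ℂ → (Fin n → ℂ) × ℂ → ℂ) :
    IsBergmanKernel (hartogsTriangle n k) B ↔
      ∀ p ∈ hartogsTriangle n k, ∀ q ∈ hartogsTriangle n k, B p q = hartogsKernel n k p q := by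
  have hK := isBergmanKernel_hartogsKernel hn hk
  exact ⟨fun hB _ hp _ hq => hB.eq_on isOpen_hartogsTriangle hK hp hq,
    fun h => hK.congr measurableSet_hartogsTriangle h⟩
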